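/- Let $(\cdot,\cdot)_0$ and $\|\cdot\|_0$ be the inner product and norm of $L_2((0,\pi))$, and let $\mathfrak m_1=1/\sqrt{\pi}$, $\mathfrak m_k(x)=\sqrt{2/\pi}\,\cos((k-1)x)$ for $k\ge 2$, be the Fourier cosine basis of $L_2((0,\pi))$. Let $\dot W=\{\dot W(h):h\in L_2((0,\pi))\}$ be a Gaussian white noise on a probability space, that is, a collection of Gaussian random variables with $\mathbb E\,\dot W(h)=0$ and $\mathbb E\big(\dot W(g)\dot W(h)\big)=(g,h)_0$. For a multi-index $\alpha=(\alpha_1,\alpha_2,\ldots)$ of non-negative integers with $|\alpha|=\sum_k\alpha_k<\infty$, put $\xi_\alpha=\prod_k \mathrm{He}_{\alpha_k}(\dot W(\mathfrak m_k))/\sqrt{\alpha_k!}$, where $\mathrm{He}_n(x)=(-1)^ne^{x^2/2}\frac{d^n}{dx^n}e^{-x^2/2}$. Let $L_2(W;L_2((0,\pi)))$ be the space of $L_2((0,\pi))$-valued random elements $\eta$ that are measurable with respect to the sigma-algebra generated by $\dot W$ and satisfy $\mathbb E\|\eta\|_0^2<\infty$; write $\eta_\alpha=\mathbb E(\eta\,\xi_\alpha)$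 and, for $q>1$, let $L_{2,q}(W;L_2((0,\pi)))$ be the set of $\eta\in L_2(W;L_2((0,\pi)))$ with $\sum_\alpha q^{|\alpha|}\|\eta_\alpha\|_0^2<\infty$. Let $u_0\in L_2((0,\pi))$ be non-random, and let $\{u_\alpha(t,\cdot)\}$ be the chaos solution of $$u_t=u_{xx}+u\diamond\dot W(x),\quad t>0,\ 0<x<\pi,\qquad u_x(t,0)=u_x(t,\pi)=0,\quad u(0,x)=u_0(x),$$ where $\diamond$ is the Wick product. That is, $u_\alpha\in C([0,T];L_2((0,\pi)))\cap L_2((0,T);H^1((0,\pi)))$ for every $T>0$ and every $\alpha$, and, in $H^{-1}((0,\pi))$ and with zero Neumann boundary conditions, $$\frac{\partial u_\alpha}{\partial t}=\frac{\partial^2u_\alpha}{\partial x^2}+\sum_k\sqrt{\alpha_k}\,\mathfrak m_k\,u_{\alpha-\varepsilon(k)},\qquad u_{\mathbf 0}(0)=u_0,\quad u_\alpha(0)=0\ \text{ for } |\alpha|>0,$$ where $\mathbf 0$ is the zero multi-index, and $\varepsilon(k)$ is the multi-index with $1$ in position $k$ and $0$ elsewhere. Then the following holds. 1. For every $t>0$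 and $n\ge 0$ (with $n^{-n/2}=1$ for $n=0$), $$\sum_{|\alpha|=n}\|u_\alpha(t,\cdot)\|_0^2\le C(t)^n\,n^{-n/2}\,\|u_0\|_0^2,\qquad C(t)=(4/3)^{3/2}e^{1/2}\,\Gamma(3/4)^2\,(1+\sqrt t)^2\,t^{3/2}.$$ 2. For every $t\ge 0$ there is a random element $u(t,\cdot)\in L_2(W;L_2((0,\pi)))$ such that $u(t,\cdot)=\sum_\alpha u_\alpha(t,\cdot)\,\xi_\alpha$ in mean square and $\mathbb E\big(u(t,\cdot)\,\xi_\alpha\big)=u_\alpha(t,\cdot)$ for all $\alpha$. For every $t>0$, $$u(t,\cdot)\in\bigcap_{q>1}L_{2,q}\big(W;L_2((0,\pi))\big).$$ 3. For every $t\ge 0$ and $1\le p<\infty$, $\ \mathbb E\|u(t,\cdot)\|_0^p<\infty$. -/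

import Mathlib

open MeasureTheory ProbabilityTheory Set Filter Topology
open scoped ENNReal NNReal Real

noncomputable section

namespace HeatChaos

/-- Lebesgue measure on the interval `(0, π)`. -/
abbrev intervalMeasure : Measure ℝ := volume.restrict (Ioo 0 π)

/-- The Hilbert space `L₂((0, π))`, with inner product `(·,·)₀` and norm `‖·‖₀`. -/
abbrev H : Type := Lp ℝ 2 intervalMeasure

/-- The Fourier cosine basis of `L₂((0, π))` as functions, indexed from `0`: here `cosFun k` is
`1/√π` for `k = 0` and `√(2/π) cos(kx)` for `k ≥ 1` (with indices starting at one, this is the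
basis function number `k + 1`). -/
def cosFun (k : ℕ) (x : ℝ) : ℝ :=
  if k = 0 then 1 / √π else √(2 / π) * Real.cos (k * x)

theorem continuous_cosFun (k : ℕ) : Continuous (cosFun k) := by
  unfold cosFun
  split_ifs
  · exact continuous_const
  · fun_prop

theorem abs_cosFun_le (k : ℕ) (x : ℝ) : |cosFun k x| ≤ 1 / √π + √(2 / π) := by
  have h1 : 0 ≤ 1 / √π := by positivity
  have h2 : 0 ≤ √(2 / π) := by positivity
  unfold cosFun
  split_ifs
  · rw [abs_of_nonneg h1]; linarith
  · rw [abs_mul, abs_of_nonneg h2]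
    have := mul_le_mul_of_nonneg_left (Real.abs_cos_le_one (k * x)) h2
    linarith

theorem memLp_cosFun (k : ℕ) : MemLp (cosFun k) 2 intervalMeasure :=
  MemLp.of_bound (continuous_cosFun k).aestronglyMeasurable (1 / √π + √(2 / π))
    (Eventually.of_forall fun x => by
      rw [Real.norm_eq_abs]; exact abs_cosFun_le k x)

/-- The Fourier cosine basis as elements of `L₂((0, π))`. -/
def cosBasis (k : ℕ) : H := (memLp_cosFun k).toLp (cosFun k)

/-! ### White noise and chaos spaces -/

section Chaos

variable {Ω : Type*} [MeasurableSpace Ω]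

/-- A Gaussian white noise on `L₂((0, π))`: Gaussian random variables `W h`, `h ∈ L₂((0, π))`,
with `E W(h) = 0` and `E (W(g) W(h)) = (g, h)₀`. -/
structure IsGaussianWhiteNoise (P : Measure Ω) (W : H → Ω → ℝ) : Prop where
  measurable : ∀ h, Measurable (W h)
  gaussian : ∀ h, HasGaussianLaw (W h) P
  mean : ∀ h, ∫ ω, W h ω ∂P = 0
  covariance : ∀ g h, ∫ ω, W g ω * W h ω ∂P = inner ℝ g h

/-- The sigma-algebra on `Ω` generated by all `W h`, `h ∈ L₂((0, π))`. -/
abbrev noiseSigma (W : H → Ω → ℝ) : MeasurableSpace Ω :=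
  ⨆ h, MeasurableSpace.comap (W h) inferInstance

/-- Multi-indices: sequences of non-negative integers with finitely many non-zero terms. -/
abbrev MultiIndex : Type := ℕ →₀ ℕ

/-- The order `|α| = ∑ₖ αₖ` of a multi-index. -/
def order (α : MultiIndex) : ℕ := ∑ k ∈ α.support, α k

/-- `ξ_α = ∏ₖ He_{αₖ}(ξₖ) / √(αₖ!)` with `ξₖ = W(mₖ)`, where `He_n` is the Hermite polynomial
orthogonal with respect to the standard Gaussian measure. -/
def xi (W : H → Ω → ℝ) (α : MultiIndex) (ω : Ω) : ℝ :=
  ∏ k ∈ α.support,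
    (Polynomial.aeval (W (cosBasis k) ω) (Polynomial.hermite (α k)) / √((α k).factorial : ℝ))

/-- `η ∈ L₂(W; L₂((0, π)))`: the random element `η` is measurable with respect to the
sigma-algebra of the noise, and `E ‖η‖₀² < ∞`. -/
def MemL2W (P : Measure Ω) (W : H → Ω → ℝ) (η : Ω → H) : Prop :=
  StronglyMeasurable[noiseSigma W] η ∧ MemLp η 2 P

/-- The chaos coefficient `η_α = E (η ξ_α) ∈ L₂((0, π))`. -/
def chaosCoeff (P : Measure Ω) (W : H → Ω → ℝ) (η : Ω → H) (α : MultiIndex) : H :=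
  ∫ ω, xi W α ω • η ω ∂P

/-- `η ∈ L_{2,q}(W; L₂((0, π)))`, for `q > 1`. -/
def MemL2qW (P : Measure Ω) (W : H → Ω → ℝ) (q : ℝ) (η : Ω → H) : Prop :=
  MemL2W P W η ∧ Summable fun α : MultiIndex => q ^ order α * ‖chaosCoeff P W η α‖ ^ 2

/-- `η = ∑_α c_α ξ_α`, with (unconditional) convergence in mean square. -/
def HasChaosExpansion (P : Measure Ω) (W : H → Ω → ℝ) (η : Ω → H) (c : MultiIndex → H) : Prop :=
  Tendsto (fun s : Finset MultiIndex =>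
    eLpNorm (fun ω => η ω - ∑ α ∈ s, xi W α ω • c α) 2 P) atTop (𝓝 0)

end Chaos

/-! ### The chaos solution -/

/-- The squared norm `‖f‖₁² = ∑ₖ (1 + k²) fₖ²` of the Sobolev space `H¹((0, π))`, where `fₖ` are
the cosine coefficients of `f`; it is infinite when `f ∉ H¹((0, π))`. -/
def h1NormSq (f : H) : ℝ≥0∞ :=
  ∑' k : ℕ, ENNReal.ofReal ((1 + (k : ℝ) ^ 2) * (inner ℝ (cosBasis k) f) ^ 2)

/-- The pairing `(f, φ)₀ = ∫₀^π f(x) φ(x) dx` of `f ∈ L₂((0, π))` with a function `φ`. -/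
def pairing (f : H) (φ : ℝ → ℝ) : ℝ := ∫ x in Ioo 0 π, f x * φ x

/-- A smooth test function satisfying the zero Neumann boundary conditions. -/
def IsNeumannTest (φ : ℝ → ℝ) : Prop :=
  ContDiff ℝ (⊤ : ℕ∞) φ ∧ deriv φ 0 = 0 ∧ deriv φ π = 0

/-- The chaos solution of `u_t = u_xx + u ⋄ Ẇ(x)`, `u_x(t,0) = u_x(t,π) = 0`, `u(0,·) = u₀`, that
is, a solution `(u_α)` of the propagator
`∂ₜ u_α = ∂ₓₓ u_α + ∑ₖ √αₖ mₖ u_{α - ε(k)}`, `u_0(0) = u₀`, `u_α(0) = 0` for `α ≠ 0`,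
in the normal triple `(H¹, L₂, H⁻¹)`: each `u_α` belongs to `C([0,T]; L₂) ∩ L₂((0,T); H¹)` for all
`T`, and the integrated equation holds in `H⁻¹`. The last item is expressed through test functions
`φ` with zero Neumann boundary conditions; they are dense in `H¹`, and `(v_xx, φ) = (v, φ'')₀` for
the Neumann Laplacian `v ↦ v_xx` from `H¹` to `H⁻¹`. -/
structure IsChaosSolution (u₀ : H) (u : MultiIndex → ℝ → H) : Prop where
  continuousOn : ∀ α, ContinuousOn (u α) (Ici 0)
  energy : ∀ α, ∀ T > 0, ∫⁻ t in Ioc 0 T, h1NormSq (u α t) < ∞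
  initial_zero : u 0 0 = u₀
  initial : ∀ α, α ≠ 0 → u α 0 = 0
  equation : ∀ α, ∀ t ≥ 0, ∀ φ, IsNeumannTest φ →
    pairing (u α t) φ = pairing (u α 0) φ +
      ∫ s in (0 : ℝ)..t, (pairing (u α s) (deriv (deriv φ)) +
        ∑ k ∈ α.support,
          √(α k : ℝ) * pairing (u (α - Finsupp.single k 1) s) (fun x => cosFun k x * φ x))

/-- `C(t) = (4/3)^{3/2} e^{1/2} Γ(3/4)² (1 + √t)² t^{3/2}`. -/
def levelConst (t : ℝ) : ℝ :=
  (4 / 3 : ℝ) ^ (3 / 2 : ℝ) * Real.exp (1 / 2) * Real.Gamma (3 / 4) ^ 2 * (1 + √t) ^ 2 *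
    t ^ (3 / 2 : ℝ)

end HeatChaos

end

/-!
The proof has an analytic and a probabilistic half, both reducing to recursions over the order of
the multi-index.

*Decay of the chaos.* Testing the propagator with the cosines turns it into scalar linear equations
for the coefficients of `u_α`, which Duhamel's formula solves (`IsChaosSolution.inner_cosBasis_eq`):
`(u_α(t), m_j)₀` is the sum over `k` of `√αₖ` times the response of mode `j` to the forcing
`mₖ u_{α - ε(k)}`. Since `∑ₖ αₖ = |α|`, the Cauchy–Schwarz inequality gives
`‖u_α‖₀² ≤ |α| ∑ₖ ‖response to mₖ u_{α - ε(k)}‖₀²`, and summation over all `α` of order `n + 1` runs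
over pairs of a multi-index of order `n` and an integer `k`. No symmetrised multiple integrals are
needed: the factors `|α|` accumulate to `n!`. Bessel's inequality in `k` and the bound
`r ^ (-1/2)` for the trace of the heat kernel control the sum over `k` and `j`
(`tsum_tsum_sq_le`), and a second Cauchy–Schwarz inequality, in time, with the weight
`(t - s) ^ (-1/4) s ^ (3n/4)`, produces a Beta integral
(`IsChaosSolution.levelNormSq_succ_le`). Iterating gives `n! Γ(3/4)^{2n} / Γ(3n/4 + 1)²` up to a
geometric factor, and `Γ(x + 1) ≥ (x / e) ^ x` turns this into the bound with `C(t)`. Parseval's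
identity for the cosines comes from the Weierstrass approximation theorem in the variable `cos x`.

*White noise.* The definition of a white noise makes each `W h` Gaussian but says nothing about
joint laws. The covariance makes `W` almost surely linear, so all linear combinations are Gaussian
and `W(m_k)`, `k ≥ 0`, are independent standard Gaussian variables
(`IsGaussianWhiteNoise.isStdGaussianSeq`). Integration by parts,
`E (X_k p(X)) = E (∂_k p(X))` for polynomials `p`, then carries the rest. Together with the creation
rule for Hermite polynomials it shows that the `ξ_α` are orthonormal, so that square-summable
coefficients define `u(t, ·)`. It also shows that the number operator acts on the chaos of order `n`
as multiplication by `n`, whence, for `F` in that chaos,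
`n E ‖F‖^{2m} ≤ (2m - 1) E ‖F‖^{2m-2} ‖DF‖²`. Young's inequality bounds `E ‖F‖^{2m}` by
`((2m - 1) / n)^m E ‖DF‖^{2m}`; as `DF` belongs to the chaos of order `n - 1` and
`E ‖DF‖² = n E ‖F‖²`, induction yields `E ‖F‖^{2m} ≤ (2m - 1)^{nm} (E ‖F‖²)^m`
(`IsStdGaussianSeq.polyExp_sum_sq_pow_le`). The geometric factor is harmless against `n ^ (-n/2)`,
so Minkowski's inequality over `n` and Fatou's lemma give all moments.
-/

noncomputable section

namespace HeatChaos

/-! ### Normalised Hermite polynomials -/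

section Hermite

open Polynomial

theorem derivative_hermite (n : ℕ) :
    derivative (hermite n) = (n : ℤ[X]) * hermite (n - 1) := by
  induction n with
  | zero => simp
  | succ n ih =>
    rw [hermite_succ, derivative_sub, derivative_mul, ih]
    cases n with
    | zero => simp
    | succ m =>
      rw [Nat.add_sub_cancel, Nat.add_sub_cancel, hermite_succ m, derivative_mul]
      simp only [derivative_natCast, derivative_X]
      push_cast
      ring

/-- The normalised Hermite polynomial `He_n / √(n!)`. -/
def normHermite (n : ℕ) : ℝ[X] := C (1 / √(n.factorial : ℝ)) * (hermite n).map (Int.castRingHom ℝ)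

theorem normHermite_zero : normHermite 0 = 1 := by simp [normHermite]

theorem sqrt_succ_mul_inv_sqrt_factorial (n : ℕ) :
    √((n : ℝ) + 1) * (1 / √((n + 1).factorial : ℝ)) = 1 / √(n.factorial : ℝ) := by
  have h : (0 : ℝ) < n + 1 := by positivity
  rw [Nat.factorial_succ, Nat.cast_mul, Nat.cast_succ, Real.sqrt_mul h.le]
  have := Real.sqrt_pos.2 h
  field_simp

theorem derivative_normHermite (n : ℕ) :
    derivative (normHermite n) = C √(n : ℝ) * normHermite (n - 1) := by
  cases n with
  | zero => simp [normHermite]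
  | succ n =>
    rw [normHermite, derivative_C_mul, derivative_map, derivative_hermite, Nat.add_sub_cancel,
      normHermite, Polynomial.map_mul, Polynomial.map_natCast, ← mul_assoc, ← mul_assoc,
      ← sqrt_succ_mul_inv_sqrt_factorial n, ← C_eq_natCast, ← C_mul, ← C_mul]
    congr 2
    have h : (0 : ℝ) ≤ n + 1 := by positivity
    push_cast
    rw [← mul_assoc, Real.mul_self_sqrt h, mul_comm]

/-- The creation operator acting on normalised Hermite polynomials. -/
theorem sqrt_succ_mul_normHermite (n : ℕ) :
    C √((n : ℝ) + 1) * normHermite (n + 1)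
      = X * normHermite n - derivative (normHermite n) := by
  rw [normHermite, ← mul_assoc, ← C_mul, sqrt_succ_mul_inv_sqrt_factorial, normHermite,
    derivative_C_mul, derivative_map, hermite_succ, Polynomial.map_sub, Polynomial.map_mul,
    Polynomial.map_X]
  ring

end Hermite

/-! ### Hermite polynomials in several variables -/

section MvHermite

open MvPolynomial

/-- The multivariate normalised Hermite polynomial `∏ₖ He_{αₖ}(xₖ) / √(αₖ!)`. -/
def mvHermite (α : MultiIndex) : MvPolynomial ℕ ℝ :=
  α.prod fun k n => Polynomial.aeval (X k : MvPolynomial ℕ ℝ) (normHermite n)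

theorem mvHermite_zero : mvHermite 0 = 1 := by simp [mvHermite]

theorem eval_mvHermite {Ω : Type*} (W : H → Ω → ℝ) (α : MultiIndex) (ω : Ω) :
    eval (fun k => W (cosBasis k) ω) (mvHermite α) = xi W α ω := by
  simp only [mvHermite, xi, Finsupp.prod, map_prod]
  refine Finset.prod_congr rfl fun k _ => ?_
  have h : eval (fun k => W (cosBasis k) ω)
      (Polynomial.aeval (X k : MvPolynomial ℕ ℝ) (normHermite (α k)))
      = Polynomial.aeval (W (cosBasis k) ω) (normHermite (α k)) := by
    have := Polynomial.aeval_algHom_apply (aeval (R := ℝ) (fun k => W (cosBasis k) ω))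
      (X k : MvPolynomial ℕ ℝ) (normHermite (α k))
    rw [aeval_X] at this
    rw [this, ← coe_aeval_eq_eval]
    rfl
  rw [h, normHermite, map_mul, Polynomial.aeval_C, ← algebraMap_int_eq,
    Polynomial.aeval_map_algebraMap]
  simp only [Algebra.algebraMap_self, RingHom.id_apply]
  ring

theorem mvHermite_eq_mul_erase (α : MultiIndex) (k : ℕ) :
    mvHermite α = Polynomial.aeval (X k : MvPolynomial ℕ ℝ) (normHermite (α k)) *
      mvHermite (α.erase k) := by
  exact (Finsupp.mul_prod_erase' α k
    (fun k n => Polynomial.aeval (X k : MvPolynomial ℕ ℝ) (normHermite n))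
    fun i => by rw [normHermite_zero, map_one]).symm

theorem pderiv_aeval_X (k j : ℕ) (p : Polynomial ℝ) :
    pderiv k (Polynomial.aeval (X j : MvPolynomial ℕ ℝ) p)
      = if j = k then Polynomial.aeval (X j) (Polynomial.derivative p) else 0 := by
  rw [Derivation.map_aeval, pderiv_X]
  by_cases h : j = k
  · subst h; simp
  · simp [h]

theorem pderiv_mvHermite_eq_zero {α : MultiIndex} {k : ℕ} (h : α k = 0) :
    pderiv k (mvHermite α) = 0 := by
  rw [mvHermite, Finsupp.prod]
  have : ∀ s : Finset ℕ, k ∉ s → pderiv k (∏ j ∈ s,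
      Polynomial.aeval (X j : MvPolynomial ℕ ℝ) (normHermite (α j))) = 0 := by
    intro s
    induction s using Finset.induction_on with
    | empty => simp
    | insert a s ha ih =>
      intro hk
      rw [Finset.mem_insert, not_or] at hk
      rw [Finset.prod_insert ha, Derivation.leibniz, ih hk.2, pderiv_aeval_X,
        if_neg (Ne.symm hk.1)]
      simp
  exact this _ (by simpa using h)

theorem erase_sub_single (α : MultiIndex) (k : ℕ) :
    (α - Finsupp.single k 1).erase k = α.erase k := by
  ext j
  by_cases h : j = k
  · subst h; simp
  · simp [Finsupp.erase_ne h, Ne.symm h]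

theorem pderiv_mvHermite (α : MultiIndex) (k : ℕ) :
    pderiv k (mvHermite α) = √(α k : ℝ) • mvHermite (α - Finsupp.single k 1) := by
  rw [mvHermite_eq_mul_erase α k, mvHermite_eq_mul_erase (α - Finsupp.single k 1) k,
    erase_sub_single, Derivation.leibniz, pderiv_mvHermite_eq_zero (by simp), pderiv_aeval_X,
    if_pos rfl, derivative_normHermite, map_mul, Polynomial.aeval_C,
    Algebra.smul_def √(α k : ℝ)]
  simp only [smul_eq_mul, mul_zero, zero_add, Finsupp.coe_tsub, Pi.sub_apply,
    Finsupp.single_eq_same]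
  ring

theorem sqrt_smul_mvHermite {α : MultiIndex} {k : ℕ} (h : α k ≠ 0) :
    √(α k : ℝ) • mvHermite α = X k * mvHermite (α - Finsupp.single k 1)
      - pderiv k (mvHermite (α - Finsupp.single k 1)) := by
  obtain ⟨n, hn⟩ := Nat.exists_eq_succ_of_ne_zero h
  have h1 := congrArg (Polynomial.aeval (X k : MvPolynomial ℕ ℝ)) (sqrt_succ_mul_normHermite n)
  simp only [map_mul, map_sub, Polynomial.aeval_C, Polynomial.aeval_X] at h1
  have h2 : (α - Finsupp.single k 1 : MultiIndex) k = n := by simp [hn]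
  rw [mvHermite_eq_mul_erase α k, mvHermite_eq_mul_erase (α - Finsupp.single k 1) k,
    erase_sub_single, Derivation.leibniz, pderiv_mvHermite_eq_zero (by simp), pderiv_aeval_X,
    if_pos rfl, Algebra.smul_def √(α k : ℝ), ← mul_assoc, h2, hn, Nat.cast_succ, h1]
  simp only [smul_eq_mul, mul_zero, zero_add]
  ring

end MvHermite

/-! ### Gaussian integration by parts -/

/-- Independent standard Gaussian random variables `X 0, X 1, …`. -/
structure IsStdGaussianSeq {Ω : Type*} [MeasurableSpace Ω] (P : Measure Ω) (X : ℕ → Ω → ℝ) :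
    Prop where
  measurable : ∀ k, Measurable (X k)
  law : ∀ k, P.map (X k) = gaussianReal 0 1
  indep : iIndepFun X P

theorem integrable_pow_gaussianReal (n : ℕ) :
    Integrable (fun x : ℝ => x ^ n) (gaussianReal 0 1) := by
  have h := (memLp_id_gaussianReal' (μ := 0) (v := 1) n (by simp)).integrable_norm_pow'
  exact (integrable_norm_iff (by fun_prop)).1 (h.congr (ae_of_all _ fun x => by simp))

theorem integral_pow_succ_gaussianReal (n : ℕ) :
    ∫ x, x ^ (n + 1) ∂gaussianReal 0 1 = n * ∫ x, x ^ (n - 1) ∂gaussianReal 0 1 := by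
  have hint : ∀ m : ℕ, Integrable fun x : ℝ => x ^ m * gaussianPDFReal 0 1 x := by
    intro m
    have h := integrable_pow_gaussianReal m
    rw [gaussianReal_of_var_ne_zero _ one_ne_zero, integrable_withDensity_iff_integrable_smul'
      (measurable_gaussianPDF 0 1) (ae_of_all _ fun x => gaussianPDF_lt_top)] at h
    exact h.congr (ae_of_all _ fun x => by
      simp only [toReal_gaussianPDF, smul_eq_mul]; ring)
  have hd : ∀ x : ℝ, HasDerivAt (fun x => -gaussianPDFReal 0 1 x)
      (x * gaussianPDFReal 0 1 x) x := by
    intro x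
    have h1 : HasDerivAt (fun y : ℝ => -y ^ 2 / 2) (-x) x := by
      have := ((hasDerivAt_pow 2 x).neg).div_const 2
      refine this.congr_deriv ?_
      push_cast
      ring
    have h2 := (h1.exp.const_mul (√(2 * π))⁻¹).neg
    simp only [gaussianPDFReal_def, sub_zero, NNReal.coe_one, mul_one]
    refine h2.congr_deriv ?_
    ring
  rw [integral_gaussianReal_eq_integral_smul one_ne_zero,
    integral_gaussianReal_eq_integral_smul one_ne_zero]
  have := integral_mul_deriv_eq_deriv_mul_of_integrable (u := fun x : ℝ => x ^ n)
    (v := fun x => -gaussianPDFReal 0 1 x) (u' := fun x => n * x ^ (n - 1))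
    (v' := fun x => x * gaussianPDFReal 0 1 x) (fun x _ => hasDerivAt_pow n x) (fun x _ => hd x)
    ((hint (n + 1)).congr (ae_of_all _ fun x => by simp; ring))
    (((hint (n - 1)).const_mul (-n)).congr (ae_of_all _ fun x => by simp; ring))
    ((hint n).neg.congr (ae_of_all _ fun x => by simp))
  rw [← integral_const_mul]
  simp only [smul_eq_mul]
  convert this using 1
  · congr 1; ext x; ring
  · rw [← integral_neg]; congr 1; ext x; ring

section Functional

variable {Ω : Type*} [MeasurableSpace Ω] {P : Measure Ω}
  {X : ℕ → Ω → ℝ}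

theorem IsStdGaussianSeq.memLp_eval [IsProbabilityMeasure P]
    (hX : IsStdGaussianSeq P X) (p : MvPolynomial ℕ ℝ) :
    ∀ r : ℝ≥0∞, r ≠ ∞ → MemLp (fun ω => MvPolynomial.eval (fun k => X k ω) p) r P := by
  induction p using MvPolynomial.induction_on with
  | C a => intro r _; simpa using memLp_const a
  | add p q hp hq =>
    intro r hr
    simp only [map_add]
    exact (hp r hr).add (hq r hr)
  | mul_X p n hp =>
    intro r hr
    have h2 : (2 * r) ≠ ∞ := ENNReal.mul_ne_top ENNReal.ofNat_ne_top hr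
    have hXn : MemLp (X n) (2 * r) P := by
      have := memLp_id_gaussianReal' (μ := 0) (v := 1) (2 * r) h2
      rw [← hX.law n] at this
      exact this.comp_of_map (hX.measurable n).aemeasurable
    have : ENNReal.HolderTriple (2 * r) (2 * r) r := ⟨by
      rw [ENNReal.mul_inv (by simp) (by simp), ← add_mul, ENNReal.inv_two_add_inv_two, one_mul]⟩
    simp only [map_mul, MvPolynomial.eval_X]
    exact hXn.mul (r := r) (hp (2 * r) h2)

variable (P X) in
/-- The expectation of a polynomial in the random variables `X k`. -/
def polyExp (p : MvPolynomial ℕ ℝ) : ℝ := ∫ ω, MvPolynomial.eval (fun k => X k ω) p ∂P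

theorem IsStdGaussianSeq.integrable_eval [IsProbabilityMeasure P]
    (hX : IsStdGaussianSeq P X) (p : MvPolynomial ℕ ℝ) :
    Integrable (fun ω => MvPolynomial.eval (fun k => X k ω) p) P :=
  memLp_one_iff_integrable.1 (hX.memLp_eval p 1 (by simp))

theorem IsStdGaussianSeq.polyExp_add [IsProbabilityMeasure P]
    (hX : IsStdGaussianSeq P X) (p q : MvPolynomial ℕ ℝ) :
    polyExp P X (p + q) = polyExp P X p + polyExp P X q := by
  simp only [polyExp, map_add]
  exact integral_add (hX.integrable_eval p) (hX.integrable_eval q)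

theorem polyExp_smul (c : ℝ) (p : MvPolynomial ℕ ℝ) :
    polyExp P X (c • p) = c * polyExp P X p := by
  simp only [polyExp, MvPolynomial.smul_eval]
  exact integral_const_mul _ _

theorem polyExp_one [IsProbabilityMeasure P] : polyExp P X 1 = 1 := by simp [polyExp]

theorem polyExp_zero : polyExp P X 0 = 0 := by simp [polyExp]

theorem IsStdGaussianSeq.polyExp_sub [IsProbabilityMeasure P]
    (hX : IsStdGaussianSeq P X) (p q : MvPolynomial ℕ ℝ) :
    polyExp P X (p - q) = polyExp P X p - polyExp P X q := by
  simp only [polyExp, map_sub]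
  exact integral_sub (hX.integrable_eval p) (hX.integrable_eval q)

theorem IsStdGaussianSeq.polyExp_sum [IsProbabilityMeasure P]
    (hX : IsStdGaussianSeq P X) {ι : Type*} (s : Finset ι)
    (p : ι → MvPolynomial ℕ ℝ) :
    polyExp P X (∑ i ∈ s, p i) = ∑ i ∈ s, polyExp P X (p i) := by
  simp only [polyExp, map_sum]
  exact integral_finsetSum _ fun i _ => hX.integrable_eval _

theorem IsStdGaussianSeq.polyExp_mono [IsProbabilityMeasure P]
    (hX : IsStdGaussianSeq P X) {p q : MvPolynomial ℕ ℝ}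
    (h : ∀ x, MvPolynomial.eval x p ≤ MvPolynomial.eval x q) : polyExp P X p ≤ polyExp P X q :=
  integral_mono (hX.integrable_eval p) (hX.integrable_eval q) fun _ => h _

/-- Moments of independent variables factor. -/
theorem IsStdGaussianSeq.polyExp_monomial (hX : IsStdGaussianSeq P X) (s : Finset ℕ)
    (a : ℕ → ℕ) :
    polyExp P X (∏ j ∈ s, MvPolynomial.X j ^ a j) = ∏ j ∈ s, ∫ x, x ^ a j ∂gaussianReal 0 1 := by
  have hi : iIndepFun (fun j : s => X j) P := hX.indep.precomp Subtype.val_injective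
  have := hi.integral_fun_prod_comp (f := fun (j : s) (x : ℝ) => x ^ a j)
    (fun j => (hX.measurable j).aemeasurable) fun j => by fun_prop
  simp only [polyExp, map_prod, map_pow, MvPolynomial.eval_X]
  rw [← Finset.prod_coe_sort s fun j => ∫ x, x ^ a j ∂gaussianReal 0 1]
  simp only [← Finset.prod_coe_sort s, this]
  refine Finset.prod_congr rfl fun j _ => ?_
  rw [← hX.law j, integral_map (hX.measurable j).aemeasurable (by fun_prop)]

/-- Gaussian integration by parts: `E (X_k p(X)) = E (∂_k p(X))`. -/
theorem IsStdGaussianSeq.polyExp_X_mul [IsProbabilityMeasure P] (hX : IsStdGaussianSeq P X) (k : ℕ)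
    (p : MvPolynomial ℕ ℝ) :
    polyExp P X (MvPolynomial.X k * p) = polyExp P X (MvPolynomial.pderiv k p) := by
  induction p using MvPolynomial.induction_on' with
  | add p q hp hq => rw [mul_add, map_add, hX.polyExp_add, hX.polyExp_add, hp, hq]
  | monomial a c =>
    have hs : ∀ b : ℕ →₀ ℕ, b.support ⊆ insert k a.support → ∀ c : ℝ,
        MvPolynomial.monomial b c = c • ∏ j ∈ insert k a.support, MvPolynomial.X j ^ b j := by
      intro b hb c
      rw [MvPolynomial.monomial_eq, MvPolynomial.smul_eq_C_mul,
        Finsupp.prod_of_support_subset b hb _ fun i _ => pow_zero _]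
    have h1 : MvPolynomial.X k * MvPolynomial.monomial a c
        = MvPolynomial.monomial (Finsupp.single k 1 + a) c := by
      rw [MvPolynomial.X, MvPolynomial.monomial_mul, one_mul]
    have hk := Finset.mem_insert_self k a.support
    rw [h1, MvPolynomial.pderiv_monomial, hs _ ?_, hs _ ?_, polyExp_smul, polyExp_smul,
      hX.polyExp_monomial, hX.polyExp_monomial, ← Finset.mul_prod_erase _ _ hk,
      ← Finset.mul_prod_erase _ _ hk]
    · have : ∀ j ∈ (insert k a.support).erase k, (Finsupp.single k 1 + a : ℕ →₀ ℕ) j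
        = (a - Finsupp.single k 1 : ℕ →₀ ℕ) j := fun j hj => by
          simp [Ne.symm (Finset.ne_of_mem_erase hj)]
      rw [Finset.prod_congr rfl fun j hj => by rw [this j hj]]
      simp only [Finsupp.coe_add, Pi.add_apply, Finsupp.single_eq_same, Finsupp.coe_tsub,
        Pi.sub_apply]
      rw [add_comm 1, integral_pow_succ_gaussianReal]
      ring
    · intro j hj
      have : a j ≠ 0 := by
        intro h; simp [h] at hj
      exact Finset.mem_insert_of_mem (by simpa using this)
    · intro j hj
      by_cases h : j = k
      · simp [h]
      · simp [Ne.symm h] at hj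
        simp [hj]

/-- Duality between creation and differentiation for Hermite polynomials. -/
theorem IsStdGaussianSeq.sqrt_mul_polyExp_mvHermite_mul [IsProbabilityMeasure P]
    (hX : IsStdGaussianSeq P X)
    (α : MultiIndex) (k : ℕ) (p : MvPolynomial ℕ ℝ) (h : α k ≠ 0) :
    √(α k : ℝ) * polyExp P X (mvHermite α * p)
      = polyExp P X (mvHermite (α - Finsupp.single k 1) * MvPolynomial.pderiv k p) := by
  rw [← polyExp_smul, ← smul_mul_assoc, sqrt_smul_mvHermite h, sub_mul, hX.polyExp_sub,
    mul_assoc, hX.polyExp_X_mul, ← hX.polyExp_sub, Derivation.leibniz]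
  congr 1
  simp only [smul_eq_mul]
  ring

theorem sub_single_add_single {α : MultiIndex} {k : ℕ} (h : α k ≠ 0) :
    α - Finsupp.single k 1 + Finsupp.single k 1 = α :=
  tsub_add_cancel_of_le (Finsupp.single_le_iff.2 (Nat.one_le_iff_ne_zero.2 h))

theorem order_eq_degree (α : MultiIndex) : order α = α.degree := rfl

theorem order_eq_zero_iff {α : MultiIndex} : order α = 0 ↔ α = 0 := by
  rw [order_eq_degree, Finsupp.degree_eq_zero_iff]

theorem order_add_single (α : MultiIndex) (k : ℕ) :
    order (α + Finsupp.single k 1) = order α + 1 := by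
  simp [order_eq_degree]

theorem order_sub_single {α : MultiIndex} {k : ℕ} (h : α k ≠ 0) :
    order (α - Finsupp.single k 1) + 1 = order α := by
  rw [← order_add_single, sub_single_add_single h]

/-- Hermite polynomials of independent standard Gaussian variables are orthonormal. -/
theorem IsStdGaussianSeq.polyExp_mvHermite_mul_mvHermite [IsProbabilityMeasure P]
    (hX : IsStdGaussianSeq P X)
    (α β : MultiIndex) :
    polyExp P X (mvHermite α * mvHermite β) = if α = β then 1 else 0 := by
  induction hn : order α generalizing α β with
  | zero =>
    rw [order_eq_zero_iff] at hn
    subst hn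
    by_cases hβ : β = 0
    · subst hβ; simp [mvHermite_zero, polyExp_one]
    · obtain ⟨k, hk⟩ := Finsupp.ne_iff.1 hβ
      have h := hX.sqrt_mul_polyExp_mvHermite_mul β k (mvHermite 0) hk
      rw [pderiv_mvHermite_eq_zero (by simp), mul_zero, polyExp_zero] at h
      rw [if_neg (Ne.symm hβ), mul_comm]
      refine (mul_eq_zero.1 h).resolve_left ?_
      exact (Real.sqrt_ne_zero (Nat.cast_nonneg _)).2 (by exact_mod_cast hk)
  | succ n ih =>
    have hα : α ≠ 0 := by rintro rfl; simp [order] at hn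
    obtain ⟨k, hk⟩ := Finsupp.ne_iff.1 hα
    have h := hX.sqrt_mul_polyExp_mvHermite_mul α k (mvHermite β) hk
    have hk' : √(α k : ℝ) ≠ 0 := by
      rw [Real.sqrt_ne_zero (Nat.cast_nonneg _)]
      exact_mod_cast hk
    rw [pderiv_mvHermite, mul_smul_comm, polyExp_smul,
      ih (α - Finsupp.single k 1) _ (by have := order_sub_single hk; omega)] at h
    by_cases hβ : β k = 0
    · rw [hβ] at h
      simp only [Nat.cast_zero, Real.sqrt_zero, zero_mul] at h
      rw [(mul_eq_zero.1 h).resolve_left hk', if_neg]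
      rintro rfl
      exact hk hβ
    · by_cases hαβ : α = β
      · subst hαβ
        rw [if_pos rfl] at h ⊢
        exact mul_left_cancel₀ hk' h
      · rw [if_neg hαβ]
        rw [if_neg, mul_zero] at h
        · exact (mul_eq_zero.1 h).resolve_left hk'
        · intro h'
          exact hαβ (by rw [← sub_single_add_single hk, h', sub_single_add_single hβ])

end Functional

/-! ### Hypercontractivity of homogeneous chaos -/

/-- The polynomial chaos of order `n` in the first `N` variables. -/
def polyChaos (N n : ℕ) : Submodule ℝ (MvPolynomial ℕ ℝ) :=
  Submodule.span ℝ {p | ∃ α : MultiIndex, order α = n ∧ α.support ⊆ Finset.range N ∧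
    p = mvHermite α}

theorem mvHermite_mem_polyChaos {N n : ℕ} {α : MultiIndex} (hn : order α = n)
    (hN : α.support ⊆ Finset.range N) : mvHermite α ∈ polyChaos N n :=
  Submodule.subset_span ⟨α, hn, hN, rfl⟩

theorem pderiv_mem_polyChaos {N n : ℕ} {p : MvPolynomial ℕ ℝ} (hp : p ∈ polyChaos N (n + 1))
    (k : ℕ) : MvPolynomial.pderiv k p ∈ polyChaos N n := by
  induction hp using Submodule.span_induction with
  | mem p hp =>
    obtain ⟨α, hα, hN, rfl⟩ := hp
    by_cases hk : α k = 0
    · rw [pderiv_mvHermite_eq_zero hk]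
      exact zero_mem _
    · rw [pderiv_mvHermite]
      refine Submodule.smul_mem _ _ (mvHermite_mem_polyChaos ?_ (Finset.Subset.trans ?_ hN))
      · have := order_sub_single hk
        omega
      · exact Finsupp.support_tsub
  | zero => rw [map_zero]; exact zero_mem _
  | add p q _ _ hp hq => rw [map_add]; exact add_mem hp hq
  | smul c p _ hp => rw [Derivation.map_smul]; exact Submodule.smul_mem _ _ hp

section Hypercontractivity

variable {Ω : Type*} [MeasurableSpace Ω] {P : Measure Ω} {X : ℕ → Ω → ℝ}

/-- The number operator acts on the chaos of order `n` as multiplication by `n`. -/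
theorem IsStdGaussianSeq.nat_mul_polyExp_mul [IsProbabilityMeasure P]
    (hX : IsStdGaussianSeq P X) {N n : ℕ} {p : MvPolynomial ℕ ℝ} (hp : p ∈ polyChaos N n)
    (q : MvPolynomial ℕ ℝ) :
    n * polyExp P X (p * q) = ∑ k ∈ Finset.range N,
      polyExp P X (MvPolynomial.pderiv k p * MvPolynomial.pderiv k q) := by
  induction hp using Submodule.span_induction with
  | mem p hp =>
    obtain ⟨α, hα, hN, rfl⟩ := hp
    have hsum : (n : ℝ) = ∑ k ∈ Finset.range N, (α k : ℝ) := by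
      rw [← hα, order, Finset.sum_subset hN fun i _ hi => by simpa using hi]
      push_cast
      rfl
    rw [hsum, Finset.sum_mul]
    refine Finset.sum_congr rfl fun k _ => ?_
    by_cases hk : α k = 0
    · rw [pderiv_mvHermite_eq_zero hk, hk, zero_mul, polyExp_zero]
      simp
    · rw [pderiv_mvHermite, smul_mul_assoc, polyExp_smul,
        ← hX.sqrt_mul_polyExp_mvHermite_mul α k q hk, ← mul_assoc,
        Real.mul_self_sqrt (Nat.cast_nonneg _)]
  | zero => simp [polyExp_zero]
  | add p r _ _ hp hr =>
    simp only [map_add, add_mul, hX.polyExp_add, mul_add, hp, hr, Finset.sum_add_distrib]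
  | smul c p _ hp =>
    simp only [Derivation.map_smul, smul_mul_assoc, polyExp_smul, ← Finset.mul_sum]
    rw [← hp]
    ring

/-- Young's inequality for the exponents `(m + 1) / m` and `m + 1`, from Bernoulli's inequality. -/
theorem nat_mul_pow_pred_mul_le {a b : ℝ} (ha : 0 ≤ a) (hb : 0 ≤ b) (m : ℕ) :
    (m + 1) * (a ^ m * b) ≤ m * a ^ (m + 1) + b ^ (m + 1) := by
  rcases ha.eq_or_lt with rfl | ha
  · rcases m with _ | m
    · simp
    · have : 0 ≤ b ^ (m + 1 + 1) := by positivity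
      simpa using this
  · have h := one_add_mul_le_pow (a := b / a - 1) (by
      have : 0 ≤ b / a := by positivity
      linarith) (m + 1)
    have h2 := mul_le_mul_of_nonneg_left h (pow_pos ha (m + 1)).le
    rw [← mul_pow] at h2
    have h3 : a * (1 + (b / a - 1)) = b := by field_simp; ring
    rw [h3] at h2
    have h4 : a ^ (m + 1) * (1 + ((m + 1 : ℕ) : ℝ) * (b / a - 1))
        = (m + 1) * (a ^ m * b) - m * a ^ (m + 1) := by
      push_cast
      field_simp
      ring
    linarith

/-- The moment of order `2 (m + 1)` of an element of the `n`-th chaos (with values in a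
finite-dimensional Euclidean space) is controlled by its second moment. The number operator and the
chain rule bound the moment by that of the gradient, which lies in the chaos of order `n - 1`. -/
theorem IsStdGaussianSeq.polyExp_sum_sq_pow_le [IsProbabilityMeasure P]
    (hX : IsStdGaussianSeq P X) (N m n : ℕ) {ι : Type} [Fintype ι] (F : ι → MvPolynomial ℕ ℝ)
    (hF : ∀ i, F i ∈ polyChaos N n) :
    polyExp P X ((∑ i, F i ^ 2) ^ (m + 1))
      ≤ (2 * m + 1 : ℝ) ^ (n * (m + 1)) * polyExp P X (∑ i, F i ^ 2) ^ (m + 1) := by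
  induction n generalizing ι with
  | zero =>
    have hc : ∀ i, ∃ c, F i = MvPolynomial.C c := by
      intro i
      have hi := hF i
      have hsub : polyChaos N 0 ≤ Submodule.span ℝ {1} := by
        refine Submodule.span_mono ?_
        rintro p ⟨α, hα, -, rfl⟩
        rw [order_eq_zero_iff.1 hα, mvHermite_zero]
        rfl
      obtain ⟨c, hc⟩ := Submodule.mem_span_singleton.1 (hsub hi)
      exact ⟨c, by rw [← hc, MvPolynomial.smul_eq_C_mul, mul_one]⟩
    choose c hc using hc
    have : ∑ i, F i ^ 2 = MvPolynomial.C (∑ i, c i ^ 2) := by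
      simp [hc]
    rw [this, ← map_pow, MvPolynomial.C_eq_smul_one, polyExp_smul, polyExp_one,
      MvPolynomial.C_eq_smul_one, polyExp_smul, polyExp_one]
    simp
  | succ n ih =>
    set q := ∑ i, F i ^ 2 with hq
    let D : ι × Fin N → MvPolynomial ℕ ℝ := fun x => MvPolynomial.pderiv (x.2 : ℕ) (F x.1)
    set Q := ∑ x, D x ^ 2 with hQ
    have hD := ih D fun x => pderiv_mem_polyChaos (hF x.1) _
    rw [← hQ] at hD
    have hQsum : Q = ∑ k ∈ Finset.range N, ∑ i, MvPolynomial.pderiv k (F i) ^ 2 := by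
      rw [hQ, Fintype.sum_prod_type_right, Finset.sum_range]
    -- the second moment of the gradient
    have hE : polyExp P X Q = (n + 1) * polyExp P X q := by
      have h1 : ∀ i, (n + 1) * polyExp P X (F i ^ 2)
          = ∑ k ∈ Finset.range N, polyExp P X (MvPolynomial.pderiv k (F i) ^ 2) := by
        intro i
        have := hX.nat_mul_polyExp_mul (hF i) (F i)
        simp only [pow_two]
        rw [← this]
        push_cast
        rfl
      rw [hQsum, hq, hX.polyExp_sum, hX.polyExp_sum, Finset.mul_sum,
        Finset.sum_congr rfl fun i _ => h1 i, Finset.sum_comm]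
      exact Finset.sum_congr rfl fun k _ => hX.polyExp_sum _ _
    have evQ : ∀ x, 0 ≤ MvPolynomial.eval x Q := fun x => by
      simp only [hQ, map_sum, map_pow]; positivity
    have evq : ∀ x, 0 ≤ MvPolynomial.eval x q := fun x => by
      simp only [hq, map_sum, map_pow]; positivity
    have hder : ∀ k, MvPolynomial.pderiv k q = 2 * ∑ i, F i * MvPolynomial.pderiv k (F i) := by
      intro k
      rw [hq, map_sum, Finset.mul_sum]
      refine Finset.sum_congr rfl fun i _ => ?_
      rw [Derivation.leibniz_pow]
      simp
    -- the number operator and the chain rule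
    have hmain : (n + 1) * polyExp P X (q ^ (m + 1)) ≤ (2 * m + 1) * polyExp P X (q ^ m * Q) := by
      have h1 : (n + 1) * polyExp P X (q ^ (m + 1)) = ∑ k ∈ Finset.range N,
          polyExp P X (∑ i, MvPolynomial.pderiv k (F i) * MvPolynomial.pderiv k (F i * q ^ m)) := by
        have : q ^ (m + 1) = ∑ i, F i * (F i * q ^ m) := by
          rw [pow_succ', hq, Finset.sum_mul]
          exact Finset.sum_congr rfl fun i _ => by ring
        rw [this, hX.polyExp_sum, Finset.mul_sum]
        simp only [hX.polyExp_sum]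
        rw [Finset.sum_comm]
        refine Finset.sum_congr rfl fun i _ => ?_
        rw [← hX.nat_mul_polyExp_mul (hF i)]
        push_cast
        rfl
      rw [h1, ← polyExp_smul, ← hX.polyExp_sum]
      refine hX.polyExp_mono fun x => ?_
      rw [hQsum, map_sum, MvPolynomial.smul_eval, map_mul, map_sum, Finset.mul_sum, Finset.mul_sum]
      refine Finset.sum_le_sum fun k _ => ?_
      simp only [Derivation.leibniz, Derivation.leibniz_pow, hder, smul_eq_mul, nsmul_eq_mul,
        map_sum, map_mul, map_add, map_pow, map_natCast]
      set f : ι → ℝ := fun i => MvPolynomial.eval x (F i) with hf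
      set g : ι → ℝ := fun i => MvPolynomial.eval x (MvPolynomial.pderiv k (F i)) with hg
      set r := MvPolynomial.eval x q with hr
      have hr2 : r = ∑ i, f i ^ 2 := by simp [hr, hq, hf]
      have hr0 : 0 ≤ r := evq x
      have hcs : (∑ i, f i * g i) ^ 2 ≤ r * ∑ i, g i ^ 2 := by
        rw [hr2]
        exact Finset.sum_mul_sq_le_sq_mul_sq _ _ _
      have e2 : (MvPolynomial.eval x) 2 = 2 := map_ofNat _ 2
      rw [e2]
      have h2 : ∑ i, g i * (f i * (m * (r ^ (m - 1) * (2 * ∑ j, f j * g j))) + r ^ m * g i)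
          = 2 * m * r ^ (m - 1) * (∑ i, f i * g i) ^ 2 + r ^ m * ∑ i, g i ^ 2 := by
        generalize hS : ∑ j, f j * g j = S
        have : 2 * m * r ^ (m - 1) * S ^ 2 = 2 * m * r ^ (m - 1) * S * ∑ i, f i * g i := by
          rw [hS]; ring
        rw [this, Finset.mul_sum, Finset.mul_sum, ← Finset.sum_add_distrib]
        exact Finset.sum_congr rfl fun i _ => by ring
      rw [h2]
      have h3 : 2 * m * r ^ (m - 1) * (∑ i, f i * g i) ^ 2
          ≤ 2 * m * r ^ m * ∑ i, g i ^ 2 := by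
        rcases m with _ | m
        · simp
        · rw [Nat.add_sub_cancel, pow_succ r m, ← mul_assoc, mul_assoc (_ * r ^ m) r]
          exact mul_le_mul_of_nonneg_left hcs (by positivity)
      linarith
    -- Young's inequality absorbs the factor `q ^ m`
    set l : ℝ := (2 * m + 1) / (n + 1) with hl
    have hl0 : 0 ≤ l := by positivity
    have hyoung : (m + 1) * polyExp P X (q ^ m * (l • Q))
        ≤ m * polyExp P X (q ^ (m + 1)) + l ^ (m + 1) * polyExp P X (Q ^ (m + 1)) := by
      rw [← polyExp_smul, ← polyExp_smul, ← polyExp_smul, ← hX.polyExp_add]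
      refine hX.polyExp_mono fun x => ?_
      simp only [map_add, MvPolynomial.smul_eval, map_mul, map_pow]
      have := nat_mul_pow_pred_mul_le (evq x) (mul_nonneg hl0 (evQ x)) m
      rwa [mul_pow] at this
    rw [mul_smul_comm, polyExp_smul] at hyoung
    have h5 : polyExp P X (q ^ (m + 1)) ≤ l * polyExp P X (q ^ m * Q) := by
      rw [hl, div_mul_eq_mul_div, le_div_iff₀ (by positivity)]
      linarith
    have h6 : polyExp P X (q ^ (m + 1)) ≤ l ^ (m + 1) * polyExp P X (Q ^ (m + 1)) := by
      have := mul_le_mul_of_nonneg_left h5 (by positivity : (0 : ℝ) ≤ m + 1)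
      linarith
    refine h6.trans ((mul_le_mul_of_nonneg_left hD (by positivity)).trans_eq ?_)
    rw [hE, hl, mul_pow, div_pow, add_mul n 1, one_mul, pow_add _ (n * (m + 1))]
    field_simp

end Hypercontractivity

/-! ### White noise and independent Gaussian variables -/

section WhiteNoise

theorem coeFn_finsetSum {α E ι : Type*} [MeasurableSpace α] {μ : Measure α} [NormedAddCommGroup E]
    {p : ℝ≥0∞} (s : Finset ι) (f : ι → Lp E p μ) :
    (∑ i ∈ s, f i : Lp E p μ) =ᵐ[μ] fun x => ∑ i ∈ s, f i x := by
  classical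
  induction s using Finset.induction_on with
  | empty => simp only [Finset.sum_empty]; exact Lp.coeFn_zero E p μ
  | insert a s ha ih =>
    rw [Finset.sum_insert ha]
    filter_upwards [Lp.coeFn_add (f a) (∑ i ∈ s, f i), ih] with x h1 h2
    rw [h1, Pi.add_apply, h2, Finset.sum_insert ha]

variable {Ω : Type*} [MeasurableSpace Ω] {P : Measure Ω} {W : H → Ω → ℝ}

theorem IsGaussianWhiteNoise.inner_toLp (hW : IsGaussianWhiteNoise P W) (g h : H) :
    inner ℝ ((hW.gaussian g).memLp_two.toLp (W g)) ((hW.gaussian h).memLp_two.toLp (W h))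
      = inner ℝ g h := by
  rw [← hW.covariance, L2.inner_def]
  refine integral_congr_ae ?_
  filter_upwards [(hW.gaussian g).memLp_two.coeFn_toLp, (hW.gaussian h).memLp_two.coeFn_toLp]
    with ω h1 h2
  rw [h1, h2]
  simp [mul_comm]

/-- The linear map `h ↦ W h` from `L₂((0, π))` to the square-integrable random variables. Linearity
is not part of the definition of a white noise: it holds almost surely because the covariance makes
`E (W (g + h) - W g - W h)²` and `E (W (c h) - c W h)²` vanish. -/
def IsGaussianWhiteNoise.toLinearMap (hW : IsGaussianWhiteNoise P W) : H →ₗ[ℝ] Lp ℝ 2 P where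
  toFun h := (hW.gaussian h).memLp_two.toLp (W h)
  map_add' g h := by
    rw [← sub_eq_zero, ← inner_self_eq_zero (𝕜 := ℝ)]
    simp only [inner_sub_left, inner_sub_right, inner_add_left, inner_add_right, hW.inner_toLp]
    ring
  map_smul' c h := by
    rw [← sub_eq_zero, ← inner_self_eq_zero (𝕜 := ℝ)]
    simp only [inner_sub_left, inner_sub_right, real_inner_smul_left, real_inner_smul_right,
      hW.inner_toLp, RingHom.id_apply]
    ring

theorem IsGaussianWhiteNoise.ae_eq_sum (hW : IsGaussianWhiteNoise P W) {ι : Type*}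
    (s : Finset ι) (c : ι → ℝ) (h : ι → H) :
    W (∑ i ∈ s, c i • h i) =ᵐ[P] fun ω => ∑ i ∈ s, c i * W (h i) ω := by
  have h1 : hW.toLinearMap (∑ i ∈ s, c i • h i) = ∑ i ∈ s, c i • hW.toLinearMap (h i) := by
    simp
  have h2 : ∀ g, (hW.toLinearMap g : Ω → ℝ) =ᵐ[P] W g := fun g =>
    (hW.gaussian g).memLp_two.coeFn_toLp
  have h3 : ∀ᵐ ω ∂P, ∀ i ∈ s, (c i • hW.toLinearMap (h i) : Lp ℝ 2 P) ω = c i * W (h i) ω := by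
    rw [eventually_all_finset]
    intro i _
    filter_upwards [Lp.coeFn_smul (c i) (hW.toLinearMap (h i)), h2 (h i)] with ω h4 h5
    rw [h4, Pi.smul_apply, h5, smul_eq_mul]
  refine (h2 _).symm.trans ?_
  rw [h1]
  filter_upwards [coeFn_finsetSum s fun i => c i • hW.toLinearMap (h i), h3] with ω h4 h5
  rw [h4]
  exact Finset.sum_congr rfl h5

/-- A white noise is jointly Gaussian, since a linear combination of its values is almost surely
one of its values. -/
theorem IsGaussianWhiteNoise.hasGaussianLaw_pi (hW : IsGaussianWhiteNoise P W) {ι : Type*}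
    [Fintype ι] (h : ι → H) : HasGaussianLaw (fun ω i => W (h i) ω) P := by
  classical
  have hm : Measurable fun ω i => W (h i) ω := measurable_pi_lambda _ fun i => hW.measurable _
  refine ⟨isGaussian_of_isGaussian_map fun L => ?_⟩
  rw [Measure.map_map L.continuous.measurable hm]
  have hL : (L ∘ fun ω i => W (h i) ω) =ᵐ[P] W (∑ i, L (Pi.single i 1) • h i) := by
    refine EventuallyEq.trans (ae_of_all _ fun ω => ?_) (hW.ae_eq_sum Finset.univ _ h).symm
    have : (fun i => W (h i) ω) = ∑ i, W (h i) ω • (Pi.single i (1 : ℝ) : ι → ℝ) := by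
      ext j
      simp [Finset.sum_apply, Pi.single_apply]
    simp only [Function.comp_apply]
    rw [this, map_sum]
    refine Finset.sum_congr rfl fun i _ => ?_
    rw [map_smul, smul_eq_mul, mul_comm]
  rw [Measure.map_congr hL]
  exact (hW.gaussian _).isGaussian_map

theorem IsGaussianWhiteNoise.isStdGaussianSeq (hW : IsGaussianWhiteNoise P W) {e : ℕ → H}
    (he : Orthonormal ℝ e) : IsStdGaussianSeq P fun k => W (e k) where
  measurable k := hW.measurable _
  law k := by
    have : IsProbabilityMeasure P := (hW.gaussian (e k)).isProbabilityMeasure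
    rw [(hW.gaussian (e k)).map_eq_gaussianReal, hW.mean, variance_eq_sub
      (hW.gaussian (e k)).memLp_two, hW.mean]
    congr
    have h1 : P[W (e k) ^ 2] = 1 := by
      have := hW.covariance (e k) (e k)
      rw [real_inner_self_eq_norm_sq, he.1 k] at this
      simpa [pow_two] using this
    rw [h1]
    simp
  indep := by
    rw [iIndepFun_iff_finset]
    intro s
    refine HasGaussianLaw.iIndepFun_of_covariance_eq_zero
      (hW.hasGaussianLaw_pi fun i : s => e i) fun i j hij => ?_
    have : IsProbabilityMeasure P := (hW.gaussian (e i)).isProbabilityMeasure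
    have h1 := he.2 (fun h => hij (Subtype.ext h) : (i : ℕ) ≠ j)
    have h2 := hW.covariance (e i) (e j)
    rw [h1] at h2
    rw [Finset.restrict_def]
    rw [covariance_eq_sub (hW.gaussian _).memLp_two (hW.gaussian _).memLp_two, hW.mean]
    simpa using h2

end WhiteNoise

/-! ### The cosine basis -/

theorem cosFun_eq (k : ℕ) : ∃ a : ℝ, ∀ x, cosFun k x = a * Real.cos (k * x) := by
  by_cases h : k = 0
  · exact ⟨1 / √π, fun x => by simp [cosFun, h]⟩
  · exact ⟨√(2 / π), fun x => by simp [cosFun, h]⟩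

theorem integral_cos_nat_mul {k : ℕ} (hk : k ≠ 0) : ∫ x in (0 : ℝ)..π, Real.cos (k * x) = 0 := by
  have h : (k : ℝ) ≠ 0 := by exact_mod_cast hk
  rw [intervalIntegral.integral_comp_mul_left _ h, integral_cos]
  simp [Real.sin_nat_mul_pi]

theorem integral_cos_mul_cos (j k : ℕ) :
    ∫ x in (0 : ℝ)..π, Real.cos (j * x) * Real.cos (k * x)
      = if j = k then (if k = 0 then π else π / 2) else 0 := by
  have hexp : ∀ i j : ℕ, i ≤ j → ∀ x : ℝ, Real.cos (j * x) * Real.cos (i * x)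
      = (1 / 2) * Real.cos ((j - i : ℕ) * x) + (1 / 2) * Real.cos ((j + i : ℕ) * x) := by
    intro i j hij x
    push_cast [hij]
    rw [sub_mul, add_mul, Real.cos_sub, Real.cos_add]
    ring
  have hmain : ∀ i j : ℕ, i ≤ j → ∫ x in (0 : ℝ)..π, Real.cos (j * x) * Real.cos (i * x)
      = if j = i then (if i = 0 then π else π / 2) else 0 := by
    intro i j hij
    simp only [hexp i j hij]
    rw [intervalIntegral.integral_add (Continuous.intervalIntegrable (by fun_prop) _ _)
      (Continuous.intervalIntegrable (by fun_prop) _ _), intervalIntegral.integral_const_mul,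
      intervalIntegral.integral_const_mul]
    by_cases h : j = i
    · subst h
      by_cases h0 : j = 0
      · subst h0; simp; ring
      · rw [integral_cos_nat_mul (k := j + j) (by omega)]
        simp [h0]; ring
    · rw [integral_cos_nat_mul (k := j + i) (by omega), integral_cos_nat_mul (by omega)]
      simp [h]
  rcases le_total k j with h | h
  · exact hmain k j h
  · simp only [mul_comm (Real.cos (j * _)), hmain j k h]
    by_cases hjk : j = k
    · subst hjk; simp
    · simp [hjk, Ne.symm hjk]

theorem inner_cosBasis (k : ℕ) (f : H) : inner ℝ (cosBasis k) f = pairing f (cosFun k) := by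
  rw [L2.inner_def, pairing]
  refine integral_congr_ae ?_
  filter_upwards [(memLp_cosFun k).coeFn_toLp] with x hx
  rw [cosBasis, hx]
  rfl

theorem orthonormal_cosBasis : Orthonormal ℝ cosBasis := by
  classical
  rw [orthonormal_iff_ite]
  intro j k
  rw [inner_cosBasis, pairing]
  have h1 : ∫ x in Ioo 0 π, cosBasis k x * cosFun j x
      = ∫ x in (0 : ℝ)..π, cosFun j x * cosFun k x := by
    rw [intervalIntegral.integral_of_le Real.pi_pos.le, integral_Ioc_eq_integral_Ioo]
    refine integral_congr_ae ?_
    filter_upwards [(memLp_cosFun k).coeFn_toLp] with x hx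
    rw [cosBasis, hx, mul_comm]
  rw [h1]
  have hp := Real.pi_pos
  have s1 : √π * √π = π := Real.mul_self_sqrt hp.le
  have s2 : √(2 / π) * √(2 / π) = 2 / π := Real.mul_self_sqrt (by positivity)
  have s0 : √π ≠ 0 := (Real.sqrt_pos.2 hp).ne'
  obtain ⟨a, ha⟩ := cosFun_eq j
  obtain ⟨b, hb⟩ := cosFun_eq k
  have h2 : ∀ x, cosFun j x * cosFun k x = a * b * (Real.cos (j * x) * Real.cos (k * x)) :=
    fun x => by rw [ha, hb]; ring
  simp only [h2, intervalIntegral.integral_const_mul, integral_cos_mul_cos]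
  by_cases hjk : j = k
  · subst hjk
    have ea := ha 0
    have eb := hb 0
    by_cases h0 : j = 0
    · simp [cosFun, h0] at ea eb ⊢
      rw [← ea, ← eb]
      field_simp
      rw [pow_two, s1]
    · simp [cosFun, h0] at ea eb ⊢
      rw [← ea, ← eb]
      rw [← Real.sqrt_div (by norm_num), s2]
      field_simp
  · simp [hjk]

theorem integrable_coe (f : H) : Integrable f intervalMeasure :=
  (Lp.memLp f).integrable (by norm_num)

theorem integrable_mul_of_continuous (f : H) {g : ℝ → ℝ} (hg : Continuous g) :
    Integrable (fun x => f x * g x) intervalMeasure := by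
  obtain ⟨C, hC⟩ := isCompact_Icc.exists_bound_of_continuousOn (s := Icc 0 π) hg.continuousOn
  exact (integrable_coe f).mul_bdd (c := C) hg.aestronglyMeasurable
    ((ae_restrict_iff' measurableSet_Ioo).2 (ae_of_all _ fun x hx => hC x (Ioo_subset_Icc_self hx)))

theorem pairing_cos_pow_mul_cos_eq_zero {f : H} (hf : ∀ k, inner ℝ (cosBasis k) f = 0) (n k : ℕ) :
    pairing f (fun x => Real.cos x ^ n * Real.cos (k * x)) = 0 := by
  induction n generalizing k with
  | zero =>
    have h := hf k
    rw [inner_cosBasis] at h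
    have ha : ∃ a : ℝ, a ≠ 0 ∧ ∀ x, cosFun k x = a * Real.cos (k * x) := by
      have hp := Real.pi_pos
      by_cases h : k = 0
      · exact ⟨1 / √π, by positivity, fun x => by simp [cosFun, h]⟩
      · exact ⟨√(2 / π), by positivity, fun x => by simp [cosFun, h]⟩
    obtain ⟨a, ha0, ha⟩ := ha
    simp only [pairing, ha] at h
    have h2 : ∀ x, f x * (a * Real.cos (k * x)) = a * (f x * (Real.cos x ^ 0 * Real.cos (k * x))) :=
      fun x => by ring
    simp only [h2, integral_const_mul] at h
    exact (mul_eq_zero.1 h).resolve_left ha0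
  | succ n ih =>
    rcases k with _ | k
    · have := ih 1
      simp only [Nat.cast_one, one_mul, ← pow_succ] at this
      simpa using this
    · have h2 : ∀ x, f x * (Real.cos x ^ (n + 1) * Real.cos ((k + 1 : ℕ) * x))
          = (1 / 2) * (f x * (Real.cos x ^ n * Real.cos ((k + 2 : ℕ) * x)))
            + (1 / 2) * (f x * (Real.cos x ^ n * Real.cos (k * x))) := by
        intro x
        have e1 : ((k + 2 : ℕ) : ℝ) * x = (k + 1 : ℕ) * x + x := by push_cast; ring
        have e2 : (k : ℝ) * x = (k + 1 : ℕ) * x - x := by push_cast; ring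
        rw [e1, e2, Real.cos_add, Real.cos_sub]
        ring
      have h3 := ih (k + 2)
      have h4 := ih k
      simp only [pairing] at h3 h4 ⊢
      simp only [h2]
      rw [integral_add ((integrable_mul_of_continuous f (by fun_prop)).const_mul _)
        ((integrable_mul_of_continuous f (by fun_prop)).const_mul _), integral_const_mul,
        integral_const_mul, h3, h4]
      simp

/-- Completeness of the cosine system: on `[0, π]` every continuous function is a continuous
function of `cos x`, hence a uniform limit of polynomials in `cos x`. -/
theorem eq_zero_of_inner_cosBasis_eq_zero {f : H} (hf : ∀ k, inner ℝ (cosBasis k) f = 0) :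
    f = 0 := by
  have hpoly : ∀ p : Polynomial ℝ, pairing f (fun x => p.eval (Real.cos x)) = 0 := by
    intro p
    induction p using Polynomial.induction_on' with
    | add p q hp hq =>
      simp only [pairing, Polynomial.eval_add, mul_add] at hp hq ⊢
      rw [integral_add (integrable_mul_of_continuous f (by fun_prop))
        (integrable_mul_of_continuous f (by fun_prop)), hp, hq, add_zero]
    | monomial n a =>
      have h := pairing_cos_pow_mul_cos_eq_zero hf n 0
      simp only [pairing, Polynomial.eval_monomial, Nat.cast_zero, zero_mul, Real.cos_zero,
        mul_one] at h ⊢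
      simp only [mul_left_comm _ a, integral_const_mul, h, mul_zero]
  have hcont : ∀ g : ℝ → ℝ, Continuous g → pairing f g = 0 := by
    intro g hg
    have hbound : ∀ ε > 0, |pairing f g| ≤ ε * ∫ x in Ioo 0 π, |f x| := by
      intro ε hε
      obtain ⟨p, hp⟩ := exists_polynomial_near_of_continuousOn (-1) 1 (fun y => g (Real.arccos y))
        (hg.comp Real.continuous_arccos).continuousOn ε hε
      have h1 : pairing f g = ∫ x in Ioo 0 π, f x * (g x - p.eval (Real.cos x)) := by
        have := hpoly p
        simp only [pairing] at this ⊢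
        simp only [mul_sub]
        rw [integral_sub (integrable_mul_of_continuous f hg)
          (integrable_mul_of_continuous f (by fun_prop)), this, sub_zero]
      rw [h1, ← integral_const_mul, ← Real.norm_eq_abs]
      refine norm_integral_le_of_norm_le ((integrable_coe f).abs.const_mul ε) ?_
      refine (ae_restrict_iff' measurableSet_Ioo).2 (ae_of_all _ fun x hx => ?_)
      have h2 := hp (Real.cos x) ⟨Real.neg_one_le_cos x, Real.cos_le_one x⟩
      rw [Real.arccos_cos hx.1.le hx.2.le, abs_sub_comm] at h2
      rw [norm_mul, mul_comm, Real.norm_eq_abs, Real.norm_eq_abs]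
      exact mul_le_mul_of_nonneg_right h2.le (abs_nonneg _)
    have h0 : 0 ≤ ∫ x in Ioo 0 π, |f x| := integral_nonneg fun x => abs_nonneg _
    rw [← abs_nonpos_iff]
    refine le_of_forall_pos_le_add fun δ hδ => ?_
    refine (hbound (δ / ((∫ x in Ioo 0 π, |f x|) + 1)) (by positivity)).trans ?_
    rw [zero_add, div_mul_eq_mul_div, div_le_iff₀ (by positivity)]
    nlinarith
  have hae : ∀ᵐ x ∂intervalMeasure, f x = 0 := by
    refine ae_eq_zero_of_integral_contDiff_smul_eq_zero (integrable_coe f).locallyIntegrable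
      fun g hg _ => ?_
    have := hcont g hg.continuous
    simpa [pairing, mul_comm] using this
  exact (Lp.eq_zero_iff_ae_eq_zero).2 hae

/-- Parseval's identity for the cosine basis. -/
theorem hasSum_sq_inner_cosBasis (f : H) :
    HasSum (fun k => inner ℝ (cosBasis k) f ^ 2) (‖f‖ ^ 2) := by
  let b := HilbertBasis.mkOfOrthogonalEqBot orthonormal_cosBasis (by
    rw [Submodule.eq_bot_iff]
    intro f hf
    exact eq_zero_of_inner_cosBasis_eq_zero fun k =>
      (Submodule.mem_orthogonal _ _).1 hf _ (Submodule.subset_span ⟨k, rfl⟩))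
  have := b.hasSum_inner_mul_inner f f
  rw [real_inner_self_eq_norm_sq] at this
  refine this.congr_fun ?_
  intro k
  simp [b, pow_two, real_inner_comm]

/-! ### Chaos expansions of random elements of `L₂((0, π))` -/

section Expansion

theorem measurable_xi {Ω : Type*} (W : H → Ω → ℝ) (α : MultiIndex) :
    Measurable[noiseSigma W] (xi W α) := by
  have h : ∀ h, Measurable[noiseSigma W] (W h) := fun h =>
    Measurable.mono (comap_measurable (W h)) (le_iSup (fun h => MeasurableSpace.comap (W h) _) h)
      le_rfl
  unfold xi
  refine Finset.measurable_fun_prod _ fun k _ => Measurable.div_const ?_ _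
  exact (Polynomial.continuous_aeval _).measurable.comp (h _)

variable {Ω : Type*} [MeasurableSpace Ω] {P : Measure Ω} {W : H → Ω → ℝ}

theorem IsGaussianWhiteNoise.isStdGaussianSeq_cosBasis (hW : IsGaussianWhiteNoise P W) :
    IsStdGaussianSeq P fun k => W (cosBasis k) :=
  hW.isStdGaussianSeq orthonormal_cosBasis

theorem IsGaussianWhiteNoise.noiseSigma_le (hW : IsGaussianWhiteNoise P W) :
    noiseSigma W ≤ (inferInstance : MeasurableSpace Ω) :=
  iSup_le fun h => (hW.measurable h).comap_le

variable [IsProbabilityMeasure P]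

theorem IsGaussianWhiteNoise.memLp_xi (hW : IsGaussianWhiteNoise P W) (α : MultiIndex)
    {r : ℝ≥0∞} (hr : r ≠ ∞) : MemLp (xi W α) r P := by
  have := hW.isStdGaussianSeq_cosBasis.memLp_eval (mvHermite α) r hr
  simpa only [eval_mvHermite] using this

theorem IsGaussianWhiteNoise.memLp_xi_smul (hW : IsGaussianWhiteNoise P W) (α : MultiIndex)
    (v : H) {r : ℝ≥0∞} (hr : r ≠ ∞) : MemLp (fun ω => xi W α ω • v) r P :=
  (ContinuousLinearMap.toSpanSingleton ℝ v).comp_memLp' (hW.memLp_xi α hr)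

theorem IsGaussianWhiteNoise.integral_xi_mul_xi (hW : IsGaussianWhiteNoise P W)
    (α β : MultiIndex) : ∫ ω, xi W α ω * xi W β ω ∂P = if α = β then 1 else 0 := by
  have := hW.isStdGaussianSeq_cosBasis.polyExp_mvHermite_mul_mvHermite α β
  simpa only [polyExp, map_mul, eval_mvHermite] using this

theorem IsGaussianWhiteNoise.inner_toLp_xi_smul (hW : IsGaussianWhiteNoise P W)
    (α β : MultiIndex) (v w : H) :
    inner ℝ ((hW.memLp_xi_smul α v ENNReal.ofNat_ne_top).toLp : Lp H 2 P)
      ((hW.memLp_xi_smul β w ENNReal.ofNat_ne_top).toLp) = if α = β then inner ℝ v w else 0 := by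
  rw [L2.inner_def]
  have : ∀ᵐ ω ∂P, inner ℝ (((hW.memLp_xi_smul α v ENNReal.ofNat_ne_top).toLp : Lp H 2 P) ω)
      (((hW.memLp_xi_smul β w ENNReal.ofNat_ne_top).toLp : Lp H 2 P) ω)
      = xi W α ω * xi W β ω * inner ℝ v w := by
    filter_upwards [(hW.memLp_xi_smul α v (r := 2) ENNReal.ofNat_ne_top).coeFn_toLp,
      (hW.memLp_xi_smul β w (r := 2) ENNReal.ofNat_ne_top).coeFn_toLp] with ω h1 h2
    rw [h1, h2, real_inner_smul_left, real_inner_smul_right, mul_assoc]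
  rw [integral_congr_ae this, integral_mul_const, hW.integral_xi_mul_xi]
  simp

/-- The isometric embedding `v ↦ ξ_α v` of `L₂((0, π))` into the square-integrable random
elements. -/
def IsGaussianWhiteNoise.chaosEmbedding (hW : IsGaussianWhiteNoise P W) (α : MultiIndex) :
    H →ₗᵢ[ℝ] Lp H 2 P where
  toFun v := (hW.memLp_xi_smul α v ENNReal.ofNat_ne_top).toLp
  map_add' v w := by
    rw [← MemLp.toLp_add]
    congr 1
    ext1 ω
    simp [smul_add]
  map_smul' c v := by
    rw [RingHom.id_apply, ← MemLp.toLp_const_smul]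
    congr 1
    ext1 ω
    exact smul_comm _ _ _
  norm_map' v := by
    have h := hW.inner_toLp_xi_smul α α v v
    rw [if_pos rfl, real_inner_self_eq_norm_sq, real_inner_self_eq_norm_sq] at h
    exact (sq_eq_sq₀ (norm_nonneg _) (norm_nonneg _)).1 h

theorem IsGaussianWhiteNoise.chaosEmbedding_coeFn (hW : IsGaussianWhiteNoise P W)
    (α : MultiIndex) (v : H) : hW.chaosEmbedding α v =ᵐ[P] fun ω => xi W α ω • v :=
  (hW.memLp_xi_smul α v ENNReal.ofNat_ne_top).coeFn_toLp

theorem IsGaussianWhiteNoise.inner_chaosEmbedding (hW : IsGaussianWhiteNoise P W)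
    (α β : MultiIndex) (v w : H) :
    inner ℝ (hW.chaosEmbedding α v) (hW.chaosEmbedding β w)
      = if α = β then inner ℝ v w else 0 :=
  hW.inner_toLp_xi_smul α β v w

/-- Square-summable coefficients are the chaos coefficients of a random element. -/
theorem IsGaussianWhiteNoise.exists_hasChaosExpansion (hW : IsGaussianWhiteNoise P W)
    {c : MultiIndex → H} (hc : Summable fun α => ‖c α‖ ^ 2) :
    ∃ U : Ω → H, MemL2W P W U ∧ HasChaosExpansion P W U c ∧ ∀ α, chaosCoeff P W U α = c α := by
  have horth : OrthogonalFamily ℝ (fun _ : MultiIndex => H) hW.chaosEmbedding := by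
    intro α β hαβ v w
    rw [hW.inner_chaosEmbedding, if_neg hαβ]
  obtain ⟨V, hV⟩ := (horth.summable_iff_norm_sq_summable c).2 hc
  have hmeas : AEStronglyMeasurable[noiseSigma W] V P := by
    refine (isClosed_aestronglyMeasurable (F := H) (p := 2) (μ := P)
      hW.noiseSigma_le).mem_of_tendsto hV (Eventually.of_forall fun s => ?_)
    refine ⟨fun ω => ∑ α ∈ s, xi W α ω • c α, ?_, ?_⟩
    · exact Finset.stronglyMeasurable_fun_sum _ fun α _ =>
        (measurable_xi W α).stronglyMeasurable.smul_const _
    · have h1 : ∀ᵐ ω ∂P, ∀ α ∈ s, hW.chaosEmbedding α (c α) ω = xi W α ω • c α := by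
        rw [eventually_all_finset]
        exact fun α _ => hW.chaosEmbedding_coeFn α (c α)
      filter_upwards [coeFn_finsetSum s fun α => hW.chaosEmbedding α (c α), h1] with ω h2 h3
      rw [h2]
      exact Finset.sum_congr rfl h3
  have hUV : V =ᵐ[P] hmeas.mk V := hmeas.ae_eq_mk
  have hU2 : MemLp (hmeas.mk V) 2 P := (memLp_congr_ae hUV).1 (Lp.memLp V)
  refine ⟨hmeas.mk V, ⟨hmeas.stronglyMeasurable_mk, hU2⟩, ?_, fun α => ?_⟩
  · rw [HasSum, Lp.tendsto_Lp_iff_tendsto_eLpNorm'] at hV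
    refine hV.congr fun s => ?_
    have h1 : ∀ᵐ ω ∂P, ∀ α ∈ s, hW.chaosEmbedding α (c α) ω = xi W α ω • c α := by
      rw [eventually_all_finset]
      exact fun α _ => hW.chaosEmbedding_coeFn α (c α)
    rw [← eLpNorm_neg]
    refine eLpNorm_congr_ae ?_
    filter_upwards [coeFn_finsetSum s fun α => hW.chaosEmbedding α (c α), h1, hUV] with ω h2 h3 h4
    rw [Pi.neg_apply, Pi.sub_apply, h2, ← h4, neg_sub, Finset.sum_congr rfl h3]
  · refine ext_inner_left ℝ fun h => ?_
    have hint : Integrable (fun ω => xi W α ω • hmeas.mk V ω) P :=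
      memLp_one_iff_integrable.1 (hU2.smul (p := 2) (hW.memLp_xi α ENNReal.ofNat_ne_top))
    rw [chaosCoeff, ← integral_inner hint]
    have h1 : ∫ ω, inner ℝ h (xi W α ω • hmeas.mk V ω) ∂P
        = inner ℝ (hW.chaosEmbedding α h) V := by
      rw [L2.inner_def]
      refine integral_congr_ae ?_
      filter_upwards [hW.chaosEmbedding_coeFn α h, hUV] with ω h2 h3
      rw [h2, h3, real_inner_smul_left, real_inner_smul_right]
    rw [h1]
    have h2 := hV.mapL (innerSL ℝ (hW.chaosEmbedding α h))
    simp only [innerSL_apply_apply, hW.inner_chaosEmbedding] at h2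
    refine h2.unique ?_
    have h3 := hasSum_ite_eq α (inner ℝ h (c α) : ℝ)
    refine h3.congr_fun fun β => ?_
    by_cases hβ : β = α
    · simp [hβ]
    · simp [hβ, Ne.symm hβ]

/-! ### Moments of chaos expansions -/

/-- Hypercontractivity of the `n`-th chaos with values in `L₂((0, π))`. -/
theorem IsGaussianWhiteNoise.integral_norm_sum_pow_le (hW : IsGaussianWhiteNoise P W) (n m : ℕ)
    (s : Finset MultiIndex) (hs : ∀ α ∈ s, order α = n) (c : MultiIndex → H) :
    ∫ ω, ‖∑ α ∈ s, xi W α ω • c α‖ ^ (2 * (m + 1)) ∂P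
      ≤ (2 * m + 1 : ℝ) ^ (n * (m + 1)) * (∑ α ∈ s, ‖c α‖ ^ 2) ^ (m + 1) := by
  have hX := hW.isStdGaussianSeq_cosBasis
  classical
  let K : Submodule ℝ H := Submodule.span ℝ (s.image c : Set H)
  have : FiniteDimensional ℝ K := FiniteDimensional.span_finset ℝ _
  -- coordinates on the span of the coefficients turn `‖·‖²` into a finite sum of squares
  let b := stdOrthonormalBasis ℝ K
  have hnorm : ∀ v ∈ K, ∑ i, (inner ℝ (b i : H) v) ^ 2 = ‖v‖ ^ 2 := by
    intro v hv
    have := b.sum_sq_norm_inner_right ⟨v, hv⟩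
    simpa [Submodule.coe_inner, Real.norm_eq_abs, sq_abs] using this
  have hcK : ∀ α ∈ s, c α ∈ K := fun α hα =>
    Submodule.subset_span (Finset.mem_coe.2 (Finset.mem_image_of_mem c hα))
  let F : Fin (Module.finrank ℝ K) → MvPolynomial ℕ ℝ := fun i =>
    ∑ α ∈ s, (inner ℝ (b i : H) (c α) : ℝ) • mvHermite α
  let N := (s.biUnion fun α => α.support).sup id + 1
  have hF : ∀ i, F i ∈ polyChaos N n := by
    intro i
    refine Submodule.sum_mem _ fun α hα => Submodule.smul_mem _ _
      (mvHermite_mem_polyChaos (hs α hα) fun k hk => ?_)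
    rw [Finset.mem_range, Nat.lt_succ_iff]
    exact Finset.le_sup (f := id) (Finset.mem_biUnion.2 ⟨α, hα, hk⟩)
  have heval : ∀ ω, MvPolynomial.eval (fun k => W (cosBasis k) ω) (∑ i, F i ^ 2)
      = ‖∑ α ∈ s, xi W α ω • c α‖ ^ 2 := by
    intro ω
    rw [← hnorm _ (Submodule.sum_mem _ fun α hα => Submodule.smul_mem _ _ (hcK α hα)), map_sum]
    refine Finset.sum_congr rfl fun i _ => ?_
    simp only [F, map_pow, map_sum, MvPolynomial.smul_eval, eval_mvHermite, inner_sum,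
      real_inner_smul_right]
    congr 1
    exact Finset.sum_congr rfl fun α _ => mul_comm _ _
  have hsq : polyExp P (fun k => W (cosBasis k)) (∑ i, F i ^ 2) = ∑ α ∈ s, ‖c α‖ ^ 2 := by
    have h1 : ∀ i, polyExp P (fun k => W (cosBasis k)) (F i ^ 2)
        = ∑ α ∈ s, (inner ℝ (b i : H) (c α) : ℝ) ^ 2 := by
      intro i
      simp only [F, pow_two, Finset.sum_mul_sum, hX.polyExp_sum, smul_mul_smul_comm, polyExp_smul,
        hX.polyExp_mvHermite_mul_mvHermite]
      refine Finset.sum_congr rfl fun α hα => ?_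
      simp [hα]
    rw [hX.polyExp_sum]
    simp only [h1]
    rw [Finset.sum_comm]
    exact Finset.sum_congr rfl fun α hα => hnorm _ (hcK α hα)
  have h := hX.polyExp_sum_sq_pow_le N m n F hF
  rw [hsq] at h
  refine le_of_eq_of_le ?_ h
  simp only [polyExp, map_pow, heval, pow_mul]

theorem IsGaussianWhiteNoise.eLpNorm_sum_le (hW : IsGaussianWhiteNoise P W) (n m : ℕ)
    (s : Finset MultiIndex) (hs : ∀ α ∈ s, order α = n) (c : MultiIndex → H) :
    eLpNorm (fun ω => ∑ α ∈ s, xi W α ω • c α) ((2 * (m + 1) : ℕ) : ℝ≥0∞) P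
      ≤ ENNReal.ofReal (√(2 * m + 1) ^ n * √(∑ α ∈ s, ‖c α‖ ^ 2)) := by
  have hmem : MemLp (fun ω => ∑ α ∈ s, xi W α ω • c α) ((2 * (m + 1) : ℕ) : ℝ≥0∞) P :=
    memLp_finsetSum _ fun α _ => hW.memLp_xi_smul α (c α) (ENNReal.natCast_ne_top _)
  rw [hmem.eLpNorm_eq_integral_rpow_norm (by simp) (ENNReal.natCast_ne_top _)]
  refine ENNReal.ofReal_le_ofReal ?_
  simp only [ENNReal.toReal_natCast, Real.rpow_natCast]
  rw [Real.rpow_inv_le_iff_of_pos (integral_nonneg fun ω => by positivity) (by positivity)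
    (by positivity), Real.rpow_natCast]
  refine (hW.integral_norm_sum_pow_le n m s hs c).trans_eq ?_
  have h1 : (0 : ℝ) ≤ 2 * m + 1 := by positivity
  rw [mul_pow, pow_mul √_ 2, Real.sq_sqrt (Finset.sum_nonneg fun _ _ => by positivity), ← pow_mul,
    show n * (2 * (m + 1)) = 2 * (n * (m + 1)) by ring, pow_mul √_ 2, Real.sq_sqrt h1]

/-- A random element whose chaos components decay faster than geometrically has moments of all
orders. -/
theorem IsGaussianWhiteNoise.integrable_norm_rpow (hW : IsGaussianWhiteNoise P W)
    {c : MultiIndex → H} {U : Ω → H} (hU : MemL2W P W U) (hUc : HasChaosExpansion P W U c)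
    {A : ℕ → ℝ} (hA0 : ∀ n, 0 ≤ A n)
    (hA : ∀ n, ∀ s : Finset MultiIndex, (∀ α ∈ s, order α = n) → ∑ α ∈ s, ‖c α‖ ^ 2 ≤ A n ^ 2)
    (hsum : ∀ K : ℝ, 0 ≤ K → Summable fun n => K ^ n * A n) {p : ℝ} (hp : 1 ≤ p) :
    Integrable (fun ω => ‖U ω‖ ^ p) P := by
  obtain ⟨m, hm⟩ := exists_nat_ge p
  set r : ℝ≥0∞ := ((2 * (m + 1) : ℕ) : ℝ≥0∞) with hr
  set B : ℝ := ∑' n, √(2 * m + 1) ^ n * A n with hB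
  have hr1 : 1 ≤ r := by rw [hr]; exact_mod_cast (by omega : 1 ≤ 2 * (m + 1))
  have hmeas : ∀ s : Finset MultiIndex,
      AEStronglyMeasurable (fun ω => ∑ α ∈ s, xi W α ω • c α) P := fun s =>
    (memLp_finsetSum s fun α _ => hW.memLp_xi_smul α (c α) (r := 2)
      ENNReal.ofNat_ne_top).aestronglyMeasurable
  have hbound : ∀ s : Finset MultiIndex,
      eLpNorm (fun ω => ∑ α ∈ s, xi W α ω • c α) r P ≤ ENNReal.ofReal B := by
    intro s
    classical
    let t := s.image order
    have h1 : (fun ω => ∑ α ∈ s, xi W α ω • c α)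
        = ∑ n ∈ t, fun ω => ∑ α ∈ s with order α = n, xi W α ω • c α := by
      ext1 ω
      rw [Finset.sum_apply]
      exact (Finset.sum_fiberwise_of_maps_to (fun α hα => Finset.mem_image_of_mem order hα) _).symm
    rw [h1]
    refine (MeasureTheory.eLpNorm_sum_le (fun n _ => hmeas _) hr1).trans ?_
    have h2 : ∀ n ∈ t, eLpNorm (fun ω => ∑ α ∈ s with order α = n, xi W α ω • c α) r P
        ≤ ENNReal.ofReal (√(2 * m + 1) ^ n * A n) := by
      intro n _
      have hs : ∀ α ∈ s.filter (order · = n), order α = n := fun α hα => (Finset.mem_filter.1 hα).2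
      refine (hW.eLpNorm_sum_le n m _ hs c).trans (ENNReal.ofReal_le_ofReal ?_)
      refine mul_le_mul_of_nonneg_left ?_ (by positivity)
      rw [← Real.sqrt_sq (hA0 n)]
      exact Real.sqrt_le_sqrt (hA n _ hs)
    refine (Finset.sum_le_sum h2).trans ?_
    rw [← ENNReal.ofReal_sum_of_nonneg fun n _ => mul_nonneg (by positivity) (hA0 n)]
    exact ENNReal.ofReal_le_ofReal ((hsum _ (Real.sqrt_nonneg _)).sum_le_tsum _
      fun n _ => mul_nonneg (by positivity) (hA0 n))
  have hconv : TendstoInMeasure P (fun s : Finset MultiIndex => fun ω => ∑ α ∈ s, xi W α ω • c α)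
      atTop U := by
    refine tendstoInMeasure_of_tendsto_eLpNorm two_ne_zero hmeas hU.2.aestronglyMeasurable ?_
    refine hUc.congr fun s => ?_
    rw [← eLpNorm_neg]
    congr 1
    ext1 ω
    simp
  -- Fatou's lemma along an almost surely convergent subsequence of partial sums
  obtain ⟨ns, -, hns⟩ := hconv.exists_seq_tendsto_ae'
  have hlim := Lp.eLpNorm_lim_le_liminf_eLpNorm (p := r) (fun n => hmeas (ns n)) U hns
  have hfin : eLpNorm U r P < ∞ := by
    refine lt_of_le_of_lt (hlim.trans ?_) (ENNReal.ofReal_lt_top (r := B))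
    exact liminf_le_of_le (by isBoundedDefault) fun b hb => by
      obtain ⟨n, hn⟩ := hb.exists
      exact hn.trans (hbound _)
  have hmem : MemLp U (ENNReal.ofReal p) P := by
    refine MemLp.mono_exponent (q := r) ⟨hU.2.aestronglyMeasurable, hfin⟩ ?_
    refine (ENNReal.ofReal_le_ofReal hm).trans ?_
    rw [ENNReal.ofReal_natCast, hr]
    exact_mod_cast (by omega : m ≤ 2 * (m + 1))
  have := hmem.integrable_norm_rpow'
  rwa [ENNReal.toReal_ofReal (by linarith)] at this

end Expansion

/-! ### Cosine coefficients of the chaos solution -/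

/-- Duhamel's formula for a scalar linear equation in integrated form. -/
theorem eq_duhamel {y g : ℝ → ℝ} (l : ℝ) (hy : ContinuousOn y (Ici 0)) (hg : ContinuousOn g (Ici 0))
    (h : ∀ t ≥ 0, y t = y 0 + ∫ s in (0 : ℝ)..t, (-l * y s + g s)) {t : ℝ} (ht : 0 ≤ t) :
    y t = Real.exp (-l * t) * y 0 + ∫ s in (0 : ℝ)..t, Real.exp (-l * (t - s)) * g s := by
  have hmax : Continuous fun s : ℝ => max s 0 := by fun_prop
  have hy' : Continuous fun s => y (max s 0) :=
    hy.comp_continuous hmax fun s => mem_Ici.2 (le_max_right _ _)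
  have hg' : Continuous fun s => g (max s 0) :=
    hg.comp_continuous hmax fun s => mem_Ici.2 (le_max_right _ _)
  set f : ℝ → ℝ := fun s => -l * y (max s 0) + g (max s 0) with hf
  have hfc : Continuous f := (continuous_const.mul hy').add hg'
  -- a differentiable extension of `y` to the whole line
  set Y : ℝ → ℝ := fun t => y 0 + ∫ s in (0 : ℝ)..t, f s with hY
  have hYd : ∀ t, HasDerivAt Y (f t) t := fun t =>
    (hfc.integral_hasStrictDerivAt 0 t).hasDerivAt.const_add (y 0)
  have hYy : ∀ t ≥ 0, Y t = y t := by
    intro t ht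
    rw [h t ht]
    refine congrArg (y 0 + ·) ?_
    refine intervalIntegral.integral_congr fun s hs => ?_
    rw [uIcc_of_le ht] at hs
    simp [hf, max_eq_left hs.1]
  have hF : ∀ s, HasDerivAt (fun s => Real.exp (l * s) * Y s)
      (Real.exp (l * s) * (l * 1) * Y s + Real.exp (l * s) * f s) s := fun s =>
    (((hasDerivAt_id s).const_mul l).exp).mul (hYd s)
  have hYc : Continuous Y := continuous_iff_continuousAt.2 fun s => (hYd s).continuousAt
  have hint := intervalIntegral.integral_eq_sub_of_hasDerivAt (a := 0) (b := t)
    (fun s _ => hF s) (Continuous.intervalIntegrable (by fun_prop) _ _)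
  simp only [mul_zero, Real.exp_zero, one_mul, hYy t ht, hYy 0 le_rfl] at hint
  have h1 : ∫ s in (0 : ℝ)..t, Real.exp (-l * (t - s)) * g s
      = Real.exp (-l * t) * (Real.exp (l * t) * y t - y 0) := by
    rw [← hint, ← intervalIntegral.integral_const_mul]
    refine intervalIntegral.integral_congr fun s hs => ?_
    rw [uIcc_of_le ht] at hs
    have e : Real.exp (-l * (t - s)) = Real.exp (-l * t) * Real.exp (l * s) := by
      rw [← Real.exp_add]; ring_nf
    simp only [hf, hYy s hs.1, max_eq_left hs.1, e]
    ring
  rw [h1, mul_sub, ← mul_assoc, ← Real.exp_add]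
  simp

theorem memLp_of_continuous {ψ : ℝ → ℝ} (hψ : Continuous ψ) : MemLp ψ 2 intervalMeasure := by
  obtain ⟨C, hC⟩ := isCompact_Icc.exists_bound_of_continuousOn (s := Icc 0 π) hψ.continuousOn
  exact MemLp.of_bound hψ.aestronglyMeasurable C
    ((ae_restrict_iff' measurableSet_Ioo).2 (ae_of_all _ fun x hx => hC x (Ioo_subset_Icc_self hx)))

theorem pairing_eq_inner (f : H) {ψ : ℝ → ℝ} (hψ : Continuous ψ) :
    pairing f ψ = inner ℝ ((memLp_of_continuous hψ).toLp ψ : H) f := by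
  rw [L2.inner_def, pairing]
  refine integral_congr_ae ?_
  filter_upwards [(memLp_of_continuous hψ).coeFn_toLp] with x hx
  rw [hx]
  rfl

theorem continuousOn_pairing {v : ℝ → H} {s : Set ℝ} (hv : ContinuousOn v s) {ψ : ℝ → ℝ}
    (hψ : Continuous ψ) : ContinuousOn (fun t => pairing (v t) ψ) s := by
  simp only [pairing_eq_inner _ hψ]
  exact continuousOn_const.inner hv

theorem deriv_cosFun (k : ℕ) : ∃ a : ℝ, ∀ x, deriv (cosFun k) x = a * Real.sin (k * x) := by
  obtain ⟨a, ha⟩ := cosFun_eq k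
  refine ⟨-(a * k), fun x => ?_⟩
  have h : HasDerivAt (cosFun k) (a * (-Real.sin (k * x) * (k * 1))) x := by
    rw [funext ha]
    exact (((hasDerivAt_id x).const_mul (k : ℝ)).cos).const_mul a
  rw [h.deriv]
  ring

theorem deriv_deriv_cosFun (k : ℕ) :
    deriv (deriv (cosFun k)) = fun x => -(k : ℝ) ^ 2 * cosFun k x := by
  obtain ⟨a, ha⟩ := cosFun_eq k
  have h1 : deriv (cosFun k) = fun x => a * (-Real.sin (k * x) * (k * 1)) := by
    ext x
    rw [funext ha]
    exact ((((hasDerivAt_id x).const_mul (k : ℝ)).cos).const_mul a).deriv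
  rw [h1]
  ext x
  have h2 : HasDerivAt (fun x => a * (-Real.sin (k * x) * (k * 1)))
      (a * (-(Real.cos (k * x) * (k * 1)) * (k * 1))) x :=
    ((((hasDerivAt_id x).const_mul (k : ℝ)).sin.neg).mul_const ((k : ℝ) * 1)).const_mul a
  rw [h2.deriv, ha]
  ring

theorem isNeumannTest_cosFun (k : ℕ) : IsNeumannTest (cosFun k) := by
  obtain ⟨a, ha⟩ := cosFun_eq k
  obtain ⟨b, hb⟩ := deriv_cosFun k
  refine ⟨?_, by simp [hb], by simp [hb, Real.sin_nat_mul_pi]⟩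
  rw [funext ha]
  exact contDiff_const.mul (Real.contDiff_cos.comp (contDiff_const.mul contDiff_id))

/-- The response of the cosine coefficient number `j` at time `t` to the forcing `mₖ v`. -/
def duhamelCoeff (v : ℝ → H) (k j : ℕ) (t : ℝ) : ℝ :=
  ∫ s in (0 : ℝ)..t, Real.exp (-(j : ℝ) ^ 2 * (t - s)) *
    pairing (v s) (fun x => cosFun k x * cosFun j x)

variable {u₀ : H} {u : MultiIndex → ℝ → H}

theorem IsChaosSolution.inner_cosBasis_eq (hu : IsChaosSolution u₀ u) (α : MultiIndex) (j : ℕ)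
    {t : ℝ} (ht : 0 ≤ t) :
    inner ℝ (cosBasis j) (u α t) = Real.exp (-(j : ℝ) ^ 2 * t) * inner ℝ (cosBasis j) (u α 0)
      + ∑ k ∈ α.support, √(α k : ℝ) * duhamelCoeff (u (α - Finsupp.single k 1)) k j t := by
  have hc : ∀ k, ContinuousOn (fun s => pairing (u (α - Finsupp.single k 1) s)
      (fun x => cosFun k x * cosFun j x)) (Ici 0) := fun k =>
    continuousOn_pairing (hu.continuousOn _) ((continuous_cosFun k).mul (continuous_cosFun j))
  have h := eq_duhamel (y := fun t => pairing (u α t) (cosFun j))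
    (g := fun s => ∑ k ∈ α.support, √(α k : ℝ) *
      pairing (u (α - Finsupp.single k 1) s) (fun x => cosFun k x * cosFun j x)) ((j : ℝ) ^ 2)
    (continuousOn_pairing (hu.continuousOn α) (continuous_cosFun j))
    (continuousOn_finsetSum _ fun k _ => continuousOn_const.mul (hc k))
    (fun t ht => by
      have h1 := hu.equation α t ht _ (isNeumannTest_cosFun j)
      have h2 : ∀ s, pairing (u α s) (deriv (deriv (cosFun j)))
          = -(j : ℝ) ^ 2 * pairing (u α s) (cosFun j) := by
        intro s
        rw [deriv_deriv_cosFun, pairing, pairing, ← integral_const_mul]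
        congr 1
        ext x
        ring
      simp only [h2] at h1
      exact h1) ht
  simp only [inner_cosBasis]
  rw [h]
  congr 1
  simp only [Finset.mul_sum]
  rw [intervalIntegral.integral_finsetSum]
  · refine Finset.sum_congr rfl fun k _ => ?_
    rw [duhamelCoeff, ← intervalIntegral.integral_const_mul]
    congr 1
    ext s
    ring
  · intro k _
    refine ContinuousOn.intervalIntegrable_of_Icc ht ?_
    exact ContinuousOn.mul (by fun_prop)
      (continuousOn_const.mul ((hc k).mono Icc_subset_Ici_self))

/-! ### Square-function bounds -/

theorem cosFun_sq_le (j : ℕ) (x : ℝ) : cosFun j x ^ 2 ≤ if j = 0 then 1 / π else 2 / π := by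
  have hp := Real.pi_pos
  by_cases h : j = 0
  · simp [cosFun, h, Real.sq_sqrt hp.le]
  · simp only [cosFun, h, if_false]
    rw [mul_pow, Real.sq_sqrt (by positivity)]
    have := Real.cos_sq_le_one (j * x)
    have h2 : 0 < 2 / π := by positivity
    nlinarith

/-- Bessel's inequality for the product of `f` with a bounded function. -/
theorem tsum_sq_pairing_cosFun_mul_le (f : H) {φ : ℝ → ℝ} (hφ : Continuous φ) {C : ℝ}
    (hC : ∀ x, φ x ^ 2 ≤ C) :
    ∑' k, ENNReal.ofReal (pairing f (fun x => cosFun k x * φ x) ^ 2)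
      ≤ ENNReal.ofReal (C * ‖f‖ ^ 2) := by
  have hC0 : 0 ≤ C := (sq_nonneg _).trans (hC 0)
  have hb : ∀ x, ‖φ x‖ ≤ √C := fun x => by
    rw [Real.norm_eq_abs]; exact Real.abs_le_sqrt (hC x)
  have hg : MemLp (fun x => φ x * f x) 2 intervalMeasure :=
    (Lp.memLp f).of_le_mul (c := √C) (hφ.aestronglyMeasurable.mul (Lp.aestronglyMeasurable f))
      (ae_of_all _ fun x => by
        rw [norm_mul]; exact mul_le_mul_of_nonneg_right (hb x) (norm_nonneg _))
  have hnorm : ‖(hg.toLp : H)‖ ≤ √C * ‖f‖ := by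
    refine Lp.norm_le_mul_norm_of_ae_le_mul ?_
    filter_upwards [hg.coeFn_toLp] with x hx
    rw [hx, norm_mul]
    exact mul_le_mul_of_nonneg_right (hb x) (norm_nonneg _)
  have hpair : ∀ k, pairing f (fun x => cosFun k x * φ x)
      = inner ℝ (cosBasis k) (hg.toLp : H) := by
    intro k
    rw [inner_cosBasis, pairing, pairing]
    refine integral_congr_ae ?_
    filter_upwards [hg.coeFn_toLp] with x hx
    rw [hx]
    ring
  have hB := orthonormal_cosBasis.tsum_inner_products_le (hg.toLp : H)
  have hS := orthonormal_cosBasis.inner_products_summable (hg.toLp : H)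
  simp only [Real.norm_eq_abs, sq_abs] at hB hS
  simp only [hpair]
  rw [← ENNReal.ofReal_tsum_of_nonneg (fun _ => sq_nonneg _) hS]
  refine ENNReal.ofReal_le_ofReal (hB.trans ?_)
  have := pow_le_pow_left₀ (norm_nonneg _) hnorm 2
  rwa [mul_pow, Real.sq_sqrt hC0] at this

theorem sum_exp_neg_sq_le {r : ℝ} (hr : 0 < r) (N : ℕ) :
    ∑ j ∈ Finset.range N, Real.exp (-(2 * r) * ((j + 1 : ℕ) : ℝ) ^ 2) ≤ √(π / (2 * r)) / 2 := by
  have hanti : AntitoneOn (fun x : ℝ => Real.exp (-(2 * r) * x ^ 2)) (Icc 0 (0 + (N : ℝ))) := by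
    intro x hx y hy hxy
    refine Real.exp_le_exp.2 ?_
    have := pow_le_pow_left₀ hx.1 hxy 2
    nlinarith
  have h := hanti.sum_le_integral
  simp only [zero_add] at h
  refine h.trans ?_
  rw [← integral_gaussian_Ioi, intervalIntegral.integral_of_le (Nat.cast_nonneg N)]
  exact setIntegral_mono_set (integrable_exp_neg_mul_sq (by positivity)).integrableOn
    (ae_of_all _ fun x => (Real.exp_pos _).le) (LE.le.eventuallyLE Ioc_subset_Ioi_self)

/-- Bound for the diagonal of the Neumann heat kernel at time `2 r`, with every `m_j²` replaced by
its supremum. The constant `2/5` exceeds `1/π` and `1/√(2π)`. -/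
theorem heatTrace_le {r T : ℝ} (hr : 0 < r) (hrT : r ≤ T) :
    ∑' j : ℕ, ENNReal.ofReal (Real.exp (-(j : ℝ) ^ 2 * r) ^ 2 * if j = 0 then 1 / π else 2 / π)
      ≤ ENNReal.ofReal (2 / 5 * (1 + √T) * r ^ (-(1 / 2) : ℝ)) := by
  have hp := Real.pi_pos
  have hpos : ∀ j : ℕ, 0 ≤ Real.exp (-(j : ℝ) ^ 2 * r) ^ 2 * if j = 0 then 1 / π else 2 / π := by
    intro j
    split_ifs <;> positivity
  refine ENNReal.tsum_le_of_sum_range_le fun N => ?_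
  rw [← ENNReal.ofReal_sum_of_nonneg fun j _ => hpos j]
  refine ENNReal.ofReal_le_ofReal ?_
  have h1 : ∑ j ∈ Finset.range N,
      Real.exp (-(j : ℝ) ^ 2 * r) ^ 2 * (if j = 0 then 1 / π else 2 / π)
      ≤ 1 / π + 2 / π * (√(π / (2 * r)) / 2) := by
    refine (Finset.sum_le_sum_of_subset_of_nonneg
      (Finset.range_mono (Nat.le_succ N)) fun j _ _ => hpos j).trans ?_
    rw [Finset.sum_range_succ', add_comm]
    refine add_le_add (by simp) ?_
    refine le_trans (le_of_eq ?_) (mul_le_mul_of_nonneg_left (sum_exp_neg_sq_le hr N)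
      (by positivity))
    rw [Finset.mul_sum]
    refine Finset.sum_congr rfl fun j _ => ?_
    rw [if_neg (Nat.succ_ne_zero j), ← Real.exp_nat_mul, mul_comm]
    congr 2
    push_cast
    ring
  refine h1.trans ?_
  have hsr : 0 < √r := Real.sqrt_pos.2 hr
  have hpi := Real.pi_gt_d2
  have e1 : √(π / (2 * r)) = √(π / 2) / √r := by
    rw [← Real.sqrt_div (by positivity), div_div]
  have e2 : r ^ (-(1 / 2) : ℝ) = 1 / √r := by
    rw [Real.rpow_neg hr.le, ← Real.sqrt_eq_rpow, one_div]
  have e3 : √(π / 2) ≤ 2 / 5 * π := by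
    rw [Real.sqrt_le_left (by positivity)]
    nlinarith
  have e4 : 1 / π ≤ 2 / 5 := by
    rw [div_le_div_iff₀ hp (by norm_num)]
    linarith
  have e5 : √r ≤ √T := Real.sqrt_le_sqrt hrT
  rw [e1, e2, mul_one_div, le_div_iff₀ hsr]
  have e6 : (1 / π + 2 / π * (√(π / 2) / √r / 2)) * √r = 1 / π * √r + √(π / 2) / π := by
    field_simp
  have e7 : √(π / 2) / π ≤ 2 / 5 := by
    rw [div_le_iff₀ hp]; exact e3
  rw [e6]
  nlinarith

/-- Summed over the forcing modes `k` and the response modes `j`, the heat semigroup gains the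
singular factor `r ^ (-1/2)`. -/
theorem tsum_tsum_sq_le (f : H) {r T : ℝ} (hr : 0 < r) (hrT : r ≤ T) :
    ∑' k : ℕ, ∑' j : ℕ, ENNReal.ofReal ((Real.exp (-(j : ℝ) ^ 2 * r) *
        pairing f (fun x => cosFun k x * cosFun j x)) ^ 2)
      ≤ ENNReal.ofReal (2 / 5 * (1 + √T) * r ^ (-(1 / 2) : ℝ)) * ENNReal.ofReal (‖f‖ ^ 2) := by
  rw [ENNReal.tsum_comm]
  refine le_trans ?_ (mul_le_mul_left (heatTrace_le hr hrT) _)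
  rw [← ENNReal.tsum_mul_right]
  refine ENNReal.tsum_le_tsum fun j => ?_
  have h := tsum_sq_pairing_cosFun_mul_le f (continuous_cosFun j) (cosFun_sq_le j)
  have hC : (0 : ℝ) ≤ if j = 0 then 1 / π else 2 / π := (sq_nonneg _).trans (cosFun_sq_le j 0)
  simp only [mul_pow, ENNReal.ofReal_mul (sq_nonneg (Real.exp _)), ENNReal.tsum_mul_left]
  rw [mul_assoc, ← ENNReal.ofReal_mul hC]
  exact mul_le_mul_right h _

/-! ### Beta integrals and Gamma function estimates -/

theorem intervalIntegrable_sub_rpow_mul_rpow {b t : ℝ} (hb : 0 ≤ b) :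
    IntervalIntegrable (fun s => (t - s) ^ (-(1 / 4) : ℝ) * s ^ b) volume 0 t := by
  have h1 : IntervalIntegrable (fun s => (t - s) ^ (-(1 / 4) : ℝ)) volume 0 t := by
    have := (intervalIntegral.intervalIntegrable_rpow' (a := t) (b := 0)
      (r := (-(1 / 4) : ℝ)) (by norm_num)).comp_sub_left t
    simpa using this
  exact h1.mul_continuousOn (Real.continuous_rpow_const hb).continuousOn

theorem integral_sub_rpow_mul_rpow {b t : ℝ} (hb : 0 ≤ b) (ht : 0 < t) :
    ∫ s in (0 : ℝ)..t, (t - s) ^ (-(1 / 4) : ℝ) * s ^ b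
      = Real.Gamma (3 / 4) * Real.Gamma (b + 1) / Real.Gamma (b + 7 / 4) * t ^ (b + 3 / 4) := by
  have h := Complex.betaIntegral_scaled ((b + 1 : ℝ) : ℂ) ((3 / 4 : ℝ) : ℂ) ht
  have hl : ∫ s in (0 : ℝ)..t, (s : ℂ) ^ (((b + 1 : ℝ) : ℂ) - 1) *
      ((t : ℂ) - s) ^ (((3 / 4 : ℝ) : ℂ) - 1)
      = ((∫ s in (0 : ℝ)..t, (t - s) ^ (-(1 / 4) : ℝ) * s ^ b : ℝ) : ℂ) := by
    rw [← intervalIntegral.integral_ofReal]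
    refine intervalIntegral.integral_congr fun s hs => ?_
    rw [uIcc_of_le ht.le] at hs
    have e1 : ((b + 1 : ℝ) : ℂ) - 1 = (b : ℂ) := by push_cast; ring
    have e2 : ((3 / 4 : ℝ) : ℂ) - 1 = ((-(1 / 4) : ℝ) : ℂ) := by push_cast; ring
    simp only [e1, e2]
    rw [← Complex.ofReal_sub, ← Complex.ofReal_cpow hs.1,
      ← Complex.ofReal_cpow (sub_nonneg.2 hs.2), ← Complex.ofReal_mul, mul_comm]
  have hr : ((t : ℂ) ^ (((b + 1 : ℝ) : ℂ) + ((3 / 4 : ℝ) : ℂ) - 1))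
      = ((t ^ (b + 3 / 4) : ℝ) : ℂ) := by
    rw [Complex.ofReal_cpow ht.le]
    congr 1
    push_cast
    ring
  rw [hl, hr] at h
  have h2 := congrArg Complex.re h
  rw [Complex.ofReal_re, Complex.re_ofReal_mul,
    ← beta_eq_betaIntegralReal _ _ (by linarith) (by norm_num), beta] at h2
  rw [h2, show b + 1 + 3 / 4 = b + 7 / 4 by ring]
  ring

/-- Keep only the part `y > x` of the Gamma integral and bound `y ^ x` below by `x ^ x`. -/
theorem rpow_div_exp_le_Gamma {x : ℝ} (hx : 0 < x) : (x / Real.exp 1) ^ x ≤ Real.Gamma (x + 1) := by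
  rw [Real.Gamma_eq_integral (by linarith), add_sub_cancel_right]
  have hint := Real.GammaIntegral_convergent (s := x + 1) (by linarith)
  rw [add_sub_cancel_right] at hint
  have h1 : ∫ y in Ioi x, Real.exp (-y) * x ^ x ≤ ∫ y in Ioi 0, Real.exp (-y) * y ^ x := by
    refine le_trans (setIntegral_mono_on ?_ (hint.mono_set (Ioi_subset_Ioi hx.le))
      measurableSet_Ioi fun y hy => ?_) (setIntegral_mono_set hint ?_
        (LE.le.eventuallyLE (Ioi_subset_Ioi hx.le)))
    · exact (integrableOn_exp_neg_Ioi x).mul_const _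
    · exact mul_le_mul_of_nonneg_left
        (Real.rpow_le_rpow hx.le (le_of_lt hy) hx.le) (Real.exp_pos _).le
    · exact (ae_restrict_iff' measurableSet_Ioi).2 (ae_of_all _ fun y hy =>
        mul_nonneg (Real.exp_pos _).le (Real.rpow_nonneg (le_of_lt hy) _))
  refine le_trans (le_of_eq ?_) h1
  rw [integral_mul_const, integral_exp_neg_Ioi, Real.div_rpow hx.le (Real.exp_pos _).le,
    ← Real.exp_one_rpow (-x), Real.rpow_neg (Real.exp_pos _).le]
  field_simp

/-- The value at `7/4` enters the bound for `n = 1`, where `Γ(x + 1) ≥ (x / e) ^ x` is too weak. -/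
theorem four_fifths_le_Gamma : (4 / 5 : ℝ) ≤ Real.Gamma (7 / 4) := by
  -- log-convexity at `2 = (7/4 + 9/4) / 2` and at `9/4 = (3/4) 2 + (1/4) 3`
  have h1 := Real.Gamma_mul_add_mul_le_rpow_Gamma_mul_rpow_Gamma (s := 7 / 4) (t := 9 / 4)
    (a := 1 / 2) (b := 1 / 2) (by norm_num) (by norm_num) (by norm_num) (by norm_num) (by norm_num)
  have h2 := Real.Gamma_mul_add_mul_le_rpow_Gamma_mul_rpow_Gamma (s := 2) (t := 3)
    (a := 3 / 4) (b := 1 / 4) (by norm_num) (by norm_num) (by norm_num) (by norm_num) (by norm_num)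
  have g3 : Real.Gamma 3 = 2 := by
    rw [show (3 : ℝ) = (2 : ℕ) + 1 by norm_num, Real.Gamma_nat_eq_factorial]
    norm_num
  norm_num [g3] at h1 h2
  have hG : 0 < Real.Gamma (7 / 4) := Real.Gamma_pos_of_pos (by norm_num)
  have hG9 : 0 < Real.Gamma (9 / 4) := Real.Gamma_pos_of_pos (by norm_num)
  have h3 : (2 : ℝ) ^ (1 / 4 : ℝ) ≤ 5 / 4 := by
    have h : (2 : ℝ) ≤ (5 / 4) ^ 4 := by norm_num
    have h' := Real.rpow_le_rpow (by norm_num) h (by norm_num : (0 : ℝ) ≤ 1 / 4)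
    rw [← Real.rpow_natCast, ← Real.rpow_mul (by norm_num)] at h'
    norm_num at h' ⊢
    exact h'
  have h4 : 1 ≤ Real.Gamma (7 / 4) * Real.Gamma (9 / 4) := by
    rw [← Real.mul_rpow hG.le hG9.le, ← Real.sqrt_eq_rpow] at h1
    have := Real.one_le_sqrt.1 h1
    exact this
  nlinarith [h2.trans h3]

/-- A crude form of Stirling's formula. It fails for `n = 1`, since `2/5 > 1/e`. -/
theorem factorial_mul_pow_le {n : ℕ} (hn : 2 ≤ n) :
    (n.factorial : ℝ) * (2 / 5) ^ n ≤ (n / Real.exp 1) ^ n := by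
  have he := Real.exp_one_lt_d9
  have he0 := Real.exp_pos 1
  induction n, hn using Nat.le_induction with
  | base =>
    rw [div_pow _ (Real.exp 1), le_div_iff₀ (by positivity)]
    rw [Nat.factorial_two]
    push_cast
    nlinarith
  | succ n hn ih =>
    have hn0 : (0 : ℝ) < n := by exact_mod_cast (by omega : 0 < n)
    have hbern : (2 : ℝ) * n ^ n ≤ (n + 1 : ℝ) ^ n := by
      have h := one_add_mul_le_pow (a := 1 / (n : ℝ)) (by
        have : 0 < 1 / (n : ℝ) := by positivity
        linarith) n
      have e : (1 + 1 / (n : ℝ)) = (n + 1) / n := by field_simp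
      rw [e, div_pow, le_div_iff₀ (by positivity)] at h
      refine le_trans (le_of_eq ?_) h
      field_simp
      norm_num
    have h1 : (((n + 1).factorial : ℕ) : ℝ) * (2 / 5) ^ (n + 1)
        = (n + 1) * (2 / 5) * (n.factorial * (2 / 5) ^ n) := by
      rw [Nat.factorial_succ]; push_cast; ring
    rw [h1]
    refine (mul_le_mul_of_nonneg_left ih (by positivity)).trans ?_
    rw [div_pow, div_pow, pow_succ (Real.exp 1), ← mul_div_assoc,
      div_le_div_iff₀ (by positivity) (by positivity)]
    push_cast
    rw [pow_succ (n + 1 : ℝ)]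
    have h2 : (2 / 5) * n ^ n * Real.exp 1 ≤ (n + 1 : ℝ) ^ n := by
      have : (0 : ℝ) < n ^ n := by positivity
      nlinarith
    have h3 : (0 : ℝ) ≤ (n + 1) * Real.exp 1 ^ n := by positivity
    nlinarith [mul_le_mul_of_nonneg_left h2 h3]

/-- The numerical inequality comparing the iterated Beta integrals with `levelConst`. -/
theorem factorial_mul_pow_div_Gamma_sq_le (n : ℕ) :
    (n.factorial : ℝ) * (2 / 5) ^ n / Real.Gamma (3 * n / 4 + 1) ^ 2
      ≤ ((4 / 3 : ℝ) ^ (3 / 2 : ℝ) * Real.exp (1 / 2)) ^ n * (n : ℝ) ^ (-(n : ℝ) / 2) := by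
  have hG : 0 < Real.Gamma (3 * n / 4 + 1) := Real.Gamma_pos_of_pos (by positivity)
  rw [div_le_iff₀ (by positivity)]
  rcases (show n = 0 ∨ n = 1 ∨ 2 ≤ n by omega) with rfl | rfl | hn
  · simp
  · have h1 := four_fifths_le_Gamma
    have e : (3 * ((1 : ℕ) : ℝ) / 4 + 1) = 7 / 4 := by norm_num
    rw [e]
    have h2 : (1 : ℝ) ≤ (4 / 3 : ℝ) ^ (3 / 2 : ℝ) := Real.one_le_rpow (by norm_num) (by norm_num)
    have h3 : (1 : ℝ) ≤ Real.exp (1 / 2) := Real.one_le_exp (by norm_num)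
    have h4 : (1 : ℝ) ≤ (4 / 3 : ℝ) ^ (3 / 2 : ℝ) * Real.exp (1 / 2) := by nlinarith
    have h5 : (4 / 5 : ℝ) ^ 2 ≤ Real.Gamma (7 / 4) ^ 2 := pow_le_pow_left₀ (by norm_num) h1 2
    simp only [Nat.factorial_one, Nat.cast_one, pow_one, Real.one_rpow, mul_one, one_mul]
    nlinarith
  · have hn0 : (0 : ℝ) < n := by exact_mod_cast (by omega : 0 < n)
    have he := Real.exp_pos 1
    have h1 := rpow_div_exp_le_Gamma (x := 3 * n / 4) (by positivity)
    have h2 : (((3 * n / 4 : ℝ) / Real.exp 1) ^ (3 * n / 4 : ℝ)) ^ 2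
        ≤ Real.Gamma (3 * n / 4 + 1) ^ 2 :=
      pow_le_pow_left₀ (by positivity) h1 2
    refine le_trans ?_ (mul_le_mul_of_nonneg_left h2 (by positivity))
    refine (factorial_mul_pow_le hn).trans (le_of_eq ?_)
    have e1 : (((3 * n / 4 : ℝ) / Real.exp 1) ^ (3 * n / 4 : ℝ)) ^ 2
        = (3 / 4 : ℝ) ^ (3 * n / 2 : ℝ) * (n : ℝ) ^ (3 * n / 2 : ℝ)
          * Real.exp (-(3 * n / 2)) := by
      rw [← Real.rpow_natCast (_ ^ (3 * n / 4 : ℝ)) 2, ← Real.rpow_mul (by positivity),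
        show (3 * n / 4 : ℝ) * (2 : ℕ) = 3 * n / 2 by push_cast; ring,
        Real.div_rpow (by positivity) he.le, show (3 * n / 4 : ℝ) = 3 / 4 * n by ring,
        Real.mul_rpow (by norm_num) hn0.le, Real.exp_one_rpow, Real.exp_neg, div_eq_mul_inv]
    have e2 : ((4 / 3 : ℝ) ^ (3 / 2 : ℝ) * Real.exp (1 / 2)) ^ n
        = ((3 / 4 : ℝ) ^ (3 * n / 2 : ℝ))⁻¹ * Real.exp (n / 2) := by
      rw [mul_pow, ← Real.exp_nat_mul, ← Real.rpow_natCast, ← Real.rpow_mul (by norm_num),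
        ← Real.inv_rpow (by norm_num)]
      norm_num
      congr 2 <;> ring
    have e3 : (n / Real.exp 1) ^ n = (n : ℝ) ^ (n : ℝ) * Real.exp (-n) := by
      rw [div_pow, ← Real.exp_nat_mul, mul_one, Real.exp_neg, Real.rpow_natCast, div_eq_mul_inv]
    have e4 : (n : ℝ) ^ (n : ℝ) = (n : ℝ) ^ (-(n : ℝ) / 2) * (n : ℝ) ^ (3 * n / 2 : ℝ) := by
      rw [← Real.rpow_add hn0]
      congr 1
      ring
    have e5 : Real.exp (-n) = Real.exp (n / 2) * Real.exp (-(3 * n / 2)) := by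
      rw [← Real.exp_add]
      congr 1
      ring
    rw [e1, e2, e3, e4, e5]
    have : (0 : ℝ) < (3 / 4 : ℝ) ^ (3 * n / 2 : ℝ) := by positivity
    field_simp

/-! ### The recursion over the order of the multi-index -/

/-- Cauchy–Schwarz inequality in time with a positive weight `w`. -/
theorem ofReal_sq_integral_le {g w : ℝ → ℝ} {t : ℝ} (ht : 0 ≤ t)
    (hg : ContinuousOn g (Icc 0 t)) (hwm : Measurable w) (hw : ∀ s ∈ Ioo 0 t, 0 < w s) :
    ENNReal.ofReal ((∫ s in (0 : ℝ)..t, g s) ^ 2)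
      ≤ (∫⁻ s in Ioo 0 t, ENNReal.ofReal (w s)) *
        ∫⁻ s in Ioo 0 t, ENNReal.ofReal (g s ^ 2) / ENNReal.ofReal (w s) := by
  set μ := (volume : Measure ℝ).restrict (Ioo 0 t)
  have hgm : AEMeasurable g μ :=
    (hg.mono Ioo_subset_Icc_self).aemeasurable measurableSet_Ioo
  have h1 : ENNReal.ofReal ((∫ s in (0 : ℝ)..t, g s) ^ 2) ≤ (∫⁻ s, ‖g s‖ₑ ∂μ) ^ 2 := by
    rw [intervalIntegral.integral_of_le ht, integral_Ioc_eq_integral_Ioo, ← sq_abs,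
      ENNReal.ofReal_pow (abs_nonneg _), ← Real.norm_eq_abs, ofReal_norm]
    exact pow_le_pow_left₀ zero_le (enorm_integral_le_lintegral_enorm _) 2
  have hmem : ∀ᵐ s ∂μ, s ∈ Ioo 0 t := ae_restrict_mem measurableSet_Ioo
  have h2 : ∫⁻ s, ‖g s‖ₑ ∂μ = ∫⁻ s, ((fun s => ENNReal.ofReal √(w s)) *
      fun s => ‖g s‖ₑ / ENNReal.ofReal √(w s)) s ∂μ := by
    refine lintegral_congr_ae ?_
    filter_upwards [hmem] with s hs
    have h : ENNReal.ofReal √(w s) ≠ 0 := by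
      rw [Ne, ENNReal.ofReal_eq_zero, not_le]
      exact Real.sqrt_pos.2 (hw s hs)
    rw [Pi.mul_apply, ENNReal.mul_div_cancel h ENNReal.ofReal_ne_top]
  have h3 := ENNReal.lintegral_mul_le_Lp_mul_Lq μ (p := 2) (q := 2)
    ⟨by norm_num, by norm_num, by norm_num⟩ (f := fun s => ENNReal.ofReal √(w s))
    (g := fun s => ‖g s‖ₑ / ENNReal.ofReal √(w s)) (by fun_prop)
    (hgm.enorm.div (by fun_prop))
  rw [← h2] at h3
  refine h1.trans ((pow_le_pow_left₀ zero_le h3 2).trans (le_of_eq ?_))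
  rw [mul_pow, ← ENNReal.rpow_natCast, ← ENNReal.rpow_natCast, ← ENNReal.rpow_mul,
    ← ENNReal.rpow_mul]
  norm_num
  have h4 : ∀ s ∈ Ioo 0 t, ENNReal.ofReal √(w s) ^ 2 = ENNReal.ofReal (w s) := fun s hs => by
    rw [← ENNReal.ofReal_pow (Real.sqrt_nonneg _), Real.sq_sqrt (hw s hs).le]
  congr 1
  · refine lintegral_congr_ae ?_
    filter_upwards [hmem] with s hs
    exact h4 s hs
  · refine lintegral_congr_ae ?_
    filter_upwards [hmem] with s hs
    simp only [div_eq_mul_inv]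
    rw [mul_pow, ← ENNReal.inv_pow, h4 s hs, ← sq_abs (g s), ENNReal.ofReal_pow (abs_nonneg _),
      ← Real.norm_eq_abs, ofReal_norm]

/-- The total squared norm `∑_{|α| = n} ‖u_α(t)‖₀²` of the chaos of order `n`. -/
def levelNormSq (u : MultiIndex → ℝ → H) (n : ℕ) (t : ℝ) : ℝ≥0∞ :=
  ∑' α : {α : MultiIndex // order α = n}, ENNReal.ofReal (‖u α t‖ ^ 2)

theorem ofReal_norm_sq_eq_tsum (f : H) :
    ENNReal.ofReal (‖f‖ ^ 2) = ∑' j, ENNReal.ofReal (inner ℝ (cosBasis j) f ^ 2) := by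
  rw [← (hasSum_sq_inner_cosBasis f).tsum_eq]
  exact ENNReal.ofReal_tsum_of_nonneg (fun _ => sq_nonneg _) (hasSum_sq_inner_cosBasis f).summable

/-- Cauchy–Schwarz over `k` with the weights `√αₖ`, whose squares add up to `|α|`. Along the
recursion the factors `|α|` accumulate to the `n!` of a multiple Wiener integral. -/
theorem IsChaosSolution.ofReal_norm_sq_le (hu : IsChaosSolution u₀ u) {α : MultiIndex}
    (hα : α ≠ 0) {t : ℝ} (ht : 0 ≤ t) :
    ENNReal.ofReal (‖u α t‖ ^ 2) ≤ order α * ∑ k ∈ α.support,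
      ∑' j, ENNReal.ofReal (duhamelCoeff (u (α - Finsupp.single k 1)) k j t ^ 2) := by
  rw [ofReal_norm_sq_eq_tsum, ← Summable.tsum_finsetSum fun _ _ => ENNReal.summable,
    ← ENNReal.tsum_mul_left]
  refine ENNReal.tsum_le_tsum fun j => ?_
  rw [hu.inner_cosBasis_eq α j ht, hu.initial α hα, inner_zero_right, mul_zero, zero_add,
    ← ENNReal.ofReal_sum_of_nonneg fun _ _ => sq_nonneg _, ← ENNReal.ofReal_natCast (order α),
    ← ENNReal.ofReal_mul (Nat.cast_nonneg _)]
  refine ENNReal.ofReal_le_ofReal ((Finset.sum_mul_sq_le_sq_mul_sq _ _ _).trans_eq ?_)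
  congr 1
  rw [order]
  push_cast
  exact Finset.sum_congr rfl fun k _ => Real.sq_sqrt (Nat.cast_nonneg _)

/-- Lowering one entry of a multi-index of order `n + 1` is injective, given the position. -/
theorem tsum_sum_support_le (n : ℕ) (D : MultiIndex → ℕ → ℝ≥0∞) :
    ∑' α : {α : MultiIndex // order α = n + 1},
      ∑ k ∈ α.1.support, D (α.1 - Finsupp.single k 1) k
      ≤ ∑' β : {β : MultiIndex // order β = n}, ∑' k, D β k := by
  have h1 : ∑' α : {α : MultiIndex // order α = n + 1},
      ∑ k ∈ α.1.support, D (α.1 - Finsupp.single k 1) k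
      = ∑' p : (Σ α : {α : MultiIndex // order α = n + 1}, α.1.support),
          D (p.1.1 - Finsupp.single (p.2 : ℕ) 1) p.2 := by
    rw [ENNReal.tsum_sigma']
    refine tsum_congr fun α => ?_
    rw [tsum_fintype, Finset.sum_coe_sort α.1.support fun k => D (α.1 - Finsupp.single k 1) k]
  have hk : ∀ p : (Σ α : {α : MultiIndex // order α = n + 1}, α.1.support),
      p.1.1 (p.2 : ℕ) ≠ 0 := fun p => Finsupp.mem_support_iff.1 p.2.2
  let f : (Σ α : {α : MultiIndex // order α = n + 1}, α.1.support) →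
      {β : MultiIndex // order β = n} × ℕ := fun p =>
    (⟨p.1.1 - Finsupp.single (p.2 : ℕ) 1, by
      have h := order_sub_single (hk p)
      have h' := p.1.2
      omega⟩, p.2)
  have hf : Function.Injective f := by
    rintro ⟨⟨α, hα⟩, ⟨k, hkα⟩⟩ ⟨⟨β, hβ⟩, ⟨l, hlβ⟩⟩ h
    simp only [f, Prod.mk.injEq, Subtype.mk.injEq] at h
    obtain ⟨h, rfl⟩ := h
    have : α = β := by
      have h1 : α k ≠ 0 := Finsupp.mem_support_iff.1 hkα
      have h2 : β k ≠ 0 := Finsupp.mem_support_iff.1 hlβ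
      rw [← sub_single_add_single h1, h, sub_single_add_single h2]
    subst this
    rfl
  rw [h1, ← ENNReal.tsum_prod (f := fun (β : {β : MultiIndex // order β = n}) k => D β k)]
  exact ENNReal.tsum_comp_le_tsum_of_injective hf fun q => D q.1 q.2

theorem IsChaosSolution.levelNormSq_succ_le_tsum (hu : IsChaosSolution u₀ u) (n : ℕ) {t : ℝ}
    (ht : 0 ≤ t) :
    levelNormSq u (n + 1) t ≤ (n + 1 : ℕ) * ∑' β : {β : MultiIndex // order β = n},
      ∑' k, ∑' j, ENNReal.ofReal (duhamelCoeff (u β) k j t ^ 2) := by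
  refine le_trans ?_ (mul_le_mul_right (tsum_sum_support_le n fun β k =>
    ∑' j, ENNReal.ofReal (duhamelCoeff (u β) k j t ^ 2)) _)
  rw [← ENNReal.tsum_mul_left]
  refine ENNReal.tsum_le_tsum fun α => ?_
  have hα : α.1 ≠ 0 := fun h => by
    have := α.2
    rw [h] at this
    simp [order] at this
  have := hu.ofReal_norm_sq_le hα ht
  rwa [α.2] at this

/-- One step of the recursion over the order: a bound `A s ^ (2 b)` on the level `n` gives a bound
on the level `n + 1` through the Beta integral. -/
theorem IsChaosSolution.levelNormSq_succ_le (hu : IsChaosSolution u₀ u) (n : ℕ) {A b T : ℝ}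
    (hA : 0 ≤ A) (hb : 0 ≤ b)
    (h : ∀ s, 0 < s → s ≤ T → levelNormSq u n s ≤ ENNReal.ofReal (A * s ^ (2 * b)))
    {t : ℝ} (ht : 0 < t) (htT : t ≤ T) :
    levelNormSq u (n + 1) t ≤ ENNReal.ofReal ((n + 1) * (2 / 5 * (1 + √T)) *
      (Real.Gamma (3 / 4) * Real.Gamma (b + 1) / Real.Gamma (b + 7 / 4)) ^ 2 * A *
        t ^ (2 * (b + 3 / 4))) := by
  set K : ℝ := 2 / 5 * (1 + √T) with hK
  have hK0 : 0 ≤ K := by positivity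
  set w : ℝ → ℝ := fun s => (t - s) ^ (-(1 / 4) : ℝ) * s ^ b with hw
  have hwm : Measurable w := by
    have h1 : Measurable fun s : ℝ => t - s := by fun_prop
    exact (h1.pow_const _).mul (measurable_id.pow_const _)
  have hw0 : ∀ s ∈ Ioo 0 t, 0 < w s := fun s hs =>
    mul_pos (Real.rpow_pos_of_pos (sub_pos.2 hs.2) _) (Real.rpow_pos_of_pos hs.1 _)
  set B : ℝ := Real.Gamma (3 / 4) * Real.Gamma (b + 1) / Real.Gamma (b + 7 / 4) with hB
  have hwint : ∫⁻ s in Ioo 0 t, ENNReal.ofReal (w s) = ENNReal.ofReal (B * t ^ (b + 3 / 4)) := by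
    rw [← integral_sub_rpow_mul_rpow hb ht, intervalIntegral.integral_of_le ht.le,
      integral_Ioc_eq_integral_Ioo, ofReal_integral_eq_lintegral_ofReal]
    · exact (intervalIntegrable_iff_integrableOn_Ioo_of_le ht.le).1
        (intervalIntegrable_sub_rpow_mul_rpow hb)
    · exact (ae_restrict_iff' measurableSet_Ioo).2 (ae_of_all _ fun s hs => (hw0 s hs).le)
  let g : MultiIndex → ℕ → ℕ → ℝ → ℝ := fun β k j s => Real.exp (-(j : ℝ) ^ 2 * (t - s)) *
    pairing (u β s) (fun x => cosFun k x * cosFun j x)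
  have hg : ∀ β k j, ContinuousOn (g β k j) (Icc 0 t) := fun β k j =>
    ContinuousOn.mul (by fun_prop) ((continuousOn_pairing (hu.continuousOn β)
      ((continuous_cosFun k).mul (continuous_cosFun j))).mono Icc_subset_Ici_self)
  -- with this weight, the bound on the integrand divided by `w` is a multiple of `w` itself
  have hcs : ∀ β k j, ENNReal.ofReal (duhamelCoeff (u β) k j t ^ 2)
      ≤ ENNReal.ofReal (B * t ^ (b + 3 / 4)) *
        ∫⁻ s in Ioo 0 t, ENNReal.ofReal (g β k j s ^ 2) / ENNReal.ofReal (w s) := by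
    intro β k j
    rw [← hwint]
    exact ofReal_sq_integral_le ht.le (hg β k j) hwm hw0
  have hm : ∀ β k j, AEMeasurable (fun s => ENNReal.ofReal (g β k j s ^ 2) / ENNReal.ofReal (w s))
      (volume.restrict (Ioo 0 t)) := fun β k j =>
    ((((hg β k j).mono Ioo_subset_Icc_self).aemeasurable measurableSet_Ioo).pow_const
      2).ennreal_ofReal.div hwm.ennreal_ofReal.aemeasurable
  have hpoint : ∀ s ∈ Ioo 0 t, ∑' β : {β : MultiIndex // order β = n}, ∑' k, ∑' j,
      ENNReal.ofReal (g β k j s ^ 2) / ENNReal.ofReal (w s)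
      ≤ ENNReal.ofReal (K * A) * ENNReal.ofReal (w s) := by
    intro s hs
    have hts : 0 < t - s := sub_pos.2 hs.2
    simp only [div_eq_mul_inv, ENNReal.tsum_mul_right]
    rw [← div_eq_mul_inv]
    refine ENNReal.div_le_of_le_mul ?_
    have h1 : ∑' β : {β : MultiIndex // order β = n}, ∑' k, ∑' j, ENNReal.ofReal (g β k j s ^ 2)
        ≤ ENNReal.ofReal (K * (t - s) ^ (-(1 / 2) : ℝ)) * levelNormSq u n s := by
      rw [levelNormSq, ← ENNReal.tsum_mul_left]
      exact ENNReal.tsum_le_tsum fun β => tsum_tsum_sq_le (u β s) hts (by linarith [hs.1])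
    refine h1.trans ((mul_le_mul_right (h s hs.1 (by linarith [hs.2])) _).trans_eq ?_)
    have hw' := (hw0 s hs).le
    rw [← ENNReal.ofReal_mul (by positivity), ← ENNReal.ofReal_mul (by positivity),
      ← ENNReal.ofReal_mul (by positivity)]
    congr 1
    have e1 : (t - s) ^ (-(1 / 2) : ℝ) = (t - s) ^ (-(1 / 4) : ℝ) * (t - s) ^ (-(1 / 4) : ℝ) := by
      rw [← Real.rpow_add hts]; norm_num
    have e2 : s ^ (2 * b) = s ^ b * s ^ b := by
      rw [← Real.rpow_add hs.1, two_mul]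
    simp only [hw, e1, e2]
    ring
  have hB0 : 0 ≤ B := div_nonneg (mul_nonneg (Real.Gamma_nonneg_of_nonneg (by norm_num))
    (Real.Gamma_nonneg_of_nonneg (by linarith))) (Real.Gamma_nonneg_of_nonneg (by linarith))
  refine (hu.levelNormSq_succ_le_tsum n ht.le).trans ?_
  calc (n + 1 : ℕ) * ∑' β : {β : MultiIndex // order β = n}, ∑' k, ∑' j,
        ENNReal.ofReal (duhamelCoeff (u β) k j t ^ 2)
      ≤ (n + 1 : ℕ) * ∑' β : {β : MultiIndex // order β = n}, ∑' k, ∑' j,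
        ENNReal.ofReal (B * t ^ (b + 3 / 4)) *
          ∫⁻ s in Ioo 0 t, ENNReal.ofReal (g β k j s ^ 2) / ENNReal.ofReal (w s) := by
        gcongr with β k j
        exact hcs β k j
    _ = (n + 1 : ℕ) * (ENNReal.ofReal (B * t ^ (b + 3 / 4)) *
          ∫⁻ s in Ioo 0 t, ∑' β : {β : MultiIndex // order β = n}, ∑' k, ∑' j,
            ENNReal.ofReal (g β k j s ^ 2) / ENNReal.ofReal (w s)) := by
        simp only [ENNReal.tsum_mul_left]
        rw [lintegral_tsum fun β : {β : MultiIndex // order β = n} => AEMeasurable.tsum fun k =>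
          AEMeasurable.tsum fun j => hm β k j]
        congr 3
        ext β
        rw [lintegral_tsum fun k => AEMeasurable.tsum fun j => hm β k j]
        congr 1
        ext k
        rw [lintegral_tsum fun j => hm β k j]
    _ ≤ (n + 1 : ℕ) * (ENNReal.ofReal (B * t ^ (b + 3 / 4)) *
          ∫⁻ s in Ioo 0 t, ENNReal.ofReal (K * A) * ENNReal.ofReal (w s)) := by
        exact mul_le_mul_right (mul_le_mul_right
          (setLIntegral_mono' measurableSet_Ioo hpoint) _) _
    _ = _ := by
        rw [lintegral_const_mul _ hwm.ennreal_ofReal, hwint, ← ENNReal.ofReal_natCast,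
          ← ENNReal.ofReal_mul (by positivity), ← ENNReal.ofReal_mul (by positivity),
          ← ENNReal.ofReal_mul (by positivity)]
        congr 1
        have e : t ^ (2 * (b + 3 / 4)) = t ^ (b + 3 / 4) * t ^ (b + 3 / 4) := by
          rw [← Real.rpow_add ht, two_mul]
        rw [e]
        push_cast
        ring

theorem IsChaosSolution.levelNormSq_zero_le (hu : IsChaosSolution u₀ u) {t : ℝ} (ht : 0 ≤ t) :
    levelNormSq u 0 t ≤ ENNReal.ofReal (‖u₀‖ ^ 2) := by
  have h1 : levelNormSq u 0 t = ENNReal.ofReal (‖u 0 t‖ ^ 2) := by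
    rw [levelNormSq,
      tsum_eq_single (⟨0, order_eq_zero_iff.2 rfl⟩ : {α : MultiIndex // order α = 0})]
    rintro ⟨α, hα⟩ h
    exact absurd (Subtype.ext (order_eq_zero_iff.1 hα)) h
  rw [h1, ofReal_norm_sq_eq_tsum, ofReal_norm_sq_eq_tsum]
  refine ENNReal.tsum_le_tsum fun j => ENNReal.ofReal_le_ofReal ?_
  rw [hu.inner_cosBasis_eq 0 j ht, hu.initial_zero, Finsupp.support_zero, Finset.sum_empty,
    add_zero, mul_pow]
  refine mul_le_of_le_one_left (sq_nonneg _) (pow_le_one₀ (Real.exp_pos _).le ?_)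
  rw [Real.exp_le_one_iff]
  have : 0 ≤ (j : ℝ) ^ 2 * t := by positivity
  linarith

theorem IsChaosSolution.levelNormSq_le (hu : IsChaosSolution u₀ u) {T : ℝ} (n : ℕ) {t : ℝ}
    (ht : 0 < t) (htT : t ≤ T) :
    levelNormSq u n t ≤ ENNReal.ofReal (n.factorial * (2 / 5 * (1 + √T)) ^ n *
      (Real.Gamma (3 / 4) ^ n / Real.Gamma (3 * n / 4 + 1)) ^ 2 * ‖u₀‖ ^ 2 *
        t ^ (2 * (3 * n / 4 : ℝ))) := by
  induction n generalizing t with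
  | zero => simpa using hu.levelNormSq_zero_le ht.le
  | succ n ih =>
    refine (hu.levelNormSq_succ_le n (by positivity) (by positivity) (fun s hs hsT => ih hs hsT)
      ht htT).trans_eq ?_
    have e1 : 3 * ((n + 1 : ℕ) : ℝ) / 4 = 3 * n / 4 + 3 / 4 := by push_cast; ring
    have e2 : 3 * (n : ℝ) / 4 + 3 / 4 + 1 = 3 * n / 4 + 7 / 4 := by ring
    rw [e1, e2, Nat.factorial_succ]
    have hG : Real.Gamma (3 * n / 4 + 1) ≠ 0 := (Real.Gamma_pos_of_pos (by positivity)).ne'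
    have hG2 : Real.Gamma (3 * n / 4 + 7 / 4) ≠ 0 := (Real.Gamma_pos_of_pos (by positivity)).ne'
    congr 1
    rw [pow_succ _ n, pow_succ _ n]
    push_cast
    field_simp

/-- The chaos of order `n` decays like `n ^ (-n/2)`. -/
theorem IsChaosSolution.levelNormSq_le_levelConst (hu : IsChaosSolution u₀ u) (n : ℕ) {t : ℝ}
    (ht : 0 ≤ t) :
    levelNormSq u n t
      ≤ ENNReal.ofReal (levelConst t ^ n * (n : ℝ) ^ (-(n : ℝ) / 2) * ‖u₀‖ ^ 2) := by
  rcases ht.eq_or_lt with rfl | ht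
  · rcases n with _ | n
    · simpa using hu.levelNormSq_zero_le le_rfl
    · have h0 : levelNormSq u (n + 1) 0 = 0 := by
        refine ENNReal.tsum_eq_zero.2 fun α => ?_
        have hα : α.1 ≠ 0 := fun h => by
          have := α.2
          rw [h] at this
          simp [order] at this
        rw [hu.initial α.1 hα]
        simp
      rw [h0]
      exact zero_le
  refine (hu.levelNormSq_le n ht le_rfl).trans (ENNReal.ofReal_le_ofReal ?_)
  have h1 := factorial_mul_pow_div_Gamma_sq_le n
  have e1 : t ^ (2 * (3 * n / 4 : ℝ)) = (t ^ (3 / 2 : ℝ)) ^ n := by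
    rw [← Real.rpow_natCast, ← Real.rpow_mul ht.le]
    congr 1
    ring
  have h2 : (1 + √t) ^ n ≤ ((1 + √t) ^ 2) ^ n := by
    have : 1 ≤ 1 + √t := le_add_of_nonneg_right (Real.sqrt_nonneg t)
    exact pow_le_pow_left₀ (by positivity) (by nlinarith) n
  have hg : 0 < Real.Gamma (3 / 4) := Real.Gamma_pos_of_pos (by norm_num)
  have hG : 0 < Real.Gamma (3 * n / 4 + 1) := Real.Gamma_pos_of_pos (by positivity)
  have ht32 : 0 ≤ t ^ (3 / 2 : ℝ) := Real.rpow_nonneg ht.le _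
  calc _ = (n.factorial * (2 / 5) ^ n / Real.Gamma (3 * n / 4 + 1) ^ 2) * (1 + √t) ^ n *
        ((Real.Gamma (3 / 4) ^ 2) ^ n * ‖u₀‖ ^ 2 * (t ^ (3 / 2 : ℝ)) ^ n) := by
        rw [e1, mul_pow (2 / 5 : ℝ), div_pow _ (Real.Gamma _), ← pow_mul, ← pow_mul, mul_comm n 2]
        ring
    _ ≤ (((4 / 3 : ℝ) ^ (3 / 2 : ℝ) * Real.exp (1 / 2)) ^ n * (n : ℝ) ^ (-(n : ℝ) / 2)) *
        ((1 + √t) ^ 2) ^ n *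
        ((Real.Gamma (3 / 4) ^ 2) ^ n * ‖u₀‖ ^ 2 * (t ^ (3 / 2 : ℝ)) ^ n) := by
        refine mul_le_mul_of_nonneg_right (mul_le_mul h1 h2 (by positivity) (by positivity))
          (by positivity)
    _ = _ := by
        rw [levelConst]
        simp only [mul_pow]
        ring

/-! ### Summability of the chaos solution -/

/-- Factorial-type decay beats every geometric factor. -/
theorem summable_pow_mul_rpow_neg (K : ℝ) {d : ℝ} (hd : 0 < d) :
    Summable fun n : ℕ => K ^ n * (n : ℝ) ^ (-(n : ℝ) * d) := by
  have hlim : Tendsto (fun n : ℕ => (n : ℝ) ^ d) atTop atTop :=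
    (tendsto_rpow_atTop hd).comp tendsto_natCast_atTop_atTop
  refine Summable.of_norm_bounded_eventually_nat (g := fun n : ℕ => (1 / 2 : ℝ) ^ n)
    (summable_geometric_of_lt_one (by norm_num) (by norm_num)) ?_
  filter_upwards [hlim.eventually_ge_atTop (2 * |K| + 1)] with n hn
  have hpos : 0 < (n : ℝ) ^ d := lt_of_lt_of_le (by positivity) hn
  have e : (n : ℝ) ^ (-(n : ℝ) * d) = (((n : ℝ) ^ d)⁻¹) ^ n := by
    rw [inv_pow, ← Real.rpow_natCast, ← Real.rpow_mul (Nat.cast_nonneg _),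
      ← Real.rpow_neg (Nat.cast_nonneg _)]
    congr 1
    ring
  rw [e, ← mul_pow, norm_pow]
  refine pow_le_pow_left₀ (norm_nonneg _) ?_ n
  rw [norm_mul, norm_inv, Real.norm_of_nonneg hpos.le, Real.norm_eq_abs, ← div_eq_mul_inv,
    div_le_iff₀ hpos]
  linarith

theorem levelConst_nonneg {t : ℝ} (ht : 0 ≤ t) : 0 ≤ levelConst t := by
  unfold levelConst
  have := Real.rpow_nonneg ht (3 / 2)
  positivity

theorem IsChaosSolution.summable_level (hu : IsChaosSolution u₀ u) {t : ℝ} (ht : 0 ≤ t) (n : ℕ) :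
    Summable fun α : {α : MultiIndex // order α = n} => ‖u α t‖ ^ 2 := by
  have h := ENNReal.summable_toReal
    ((hu.levelNormSq_le_levelConst n ht).trans_lt ENNReal.ofReal_lt_top).ne
  exact h.congr fun α => ENNReal.toReal_ofReal (sq_nonneg _)

theorem IsChaosSolution.tsum_level_le (hu : IsChaosSolution u₀ u) {t : ℝ} (ht : 0 ≤ t) (n : ℕ) :
    ∑' α : {α : MultiIndex // order α = n}, ‖u α t‖ ^ 2
      ≤ levelConst t ^ n * (n : ℝ) ^ (-(n : ℝ) / 2) * ‖u₀‖ ^ 2 := by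
  have h := hu.levelNormSq_le_levelConst n ht
  have h0 := levelConst_nonneg ht
  rw [levelNormSq, ← ENNReal.ofReal_tsum_of_nonneg (fun _ => sq_nonneg _)
    (hu.summable_level ht n)] at h
  exact (ENNReal.ofReal_le_ofReal_iff (by positivity)).1 h

theorem IsChaosSolution.summable_pow_order_mul (hu : IsChaosSolution u₀ u) {t : ℝ} (ht : 0 ≤ t)
    {q : ℝ} (hq : 0 ≤ q) : Summable fun α => q ^ order α * ‖u α t‖ ^ 2 := by
  rw [← (Equiv.sigmaFiberEquiv order).summable_iff,
    summable_sigma_of_nonneg fun x => by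
      rw [Function.comp_apply]
      positivity]
  have hval : ∀ (n : ℕ) (α : {α : MultiIndex // order α = n}),
      ((fun α => q ^ order α * ‖u α t‖ ^ 2) ∘ Equiv.sigmaFiberEquiv order) ⟨n, α⟩
        = q ^ n * ‖u α t‖ ^ 2 := fun n α => by simp [α.2]
  simp only [hval]
  refine ⟨fun n => (hu.summable_level ht n).mul_left _, ?_⟩
  refine Summable.of_nonneg_of_le (fun n => tsum_nonneg fun α => by positivity) (fun n => ?_)
    ((summable_pow_mul_rpow_neg (q * levelConst t) (d := 1 / 2) (by norm_num)).mul_right (‖u₀‖ ^ 2))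
  rw [tsum_mul_left]
  refine (mul_le_mul_of_nonneg_left (hu.tsum_level_le ht n) (by positivity)).trans_eq ?_
  rw [mul_pow, show -(n : ℝ) * (1 / 2) = -(n : ℝ) / 2 by ring]
  ring

end HeatChaos

end

theorem mainTheorem4 {Ω : Type*} [MeasurableSpace Ω] (P : Measure Ω) [IsProbabilityMeasure P]
    (W : HeatChaos.H → Ω → ℝ) (hW : HeatChaos.IsGaussianWhiteNoise P W)
    (u₀ : HeatChaos.H) (u : HeatChaos.MultiIndex → ℝ → HeatChaos.H)
    (hu : HeatChaos.IsChaosSolution u₀ u) :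
    (∀ t > 0, ∀ n : ℕ,
      Summable (fun α : {α : HeatChaos.MultiIndex // HeatChaos.order α = n} => ‖u α t‖ ^ 2) ∧
      ∑' α : {α : HeatChaos.MultiIndex // HeatChaos.order α = n}, ‖u α t‖ ^ 2 ≤
        HeatChaos.levelConst t ^ n * (n : ℝ) ^ (-(n : ℝ) / 2) * ‖u₀‖ ^ 2) ∧
    ∃ U : ℝ → Ω → HeatChaos.H,
      (∀ t ≥ 0, HeatChaos.MemL2W P W (U t) ∧
        HeatChaos.HasChaosExpansion P W (U t) (fun α => u α t) ∧
        ∀ α, HeatChaos.chaosCoeff P W (U t) α = u α t) ∧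
      (∀ t > 0, ∀ q : ℝ, 1 < q → HeatChaos.MemL2qW P W q (U t)) ∧
      (∀ t ≥ 0, ∀ p : ℝ, 1 ≤ p → Integrable (fun ω => ‖U t ω‖ ^ p) P) := by
  have hex : ∀ t : ℝ, 0 ≤ t → ∃ V : Ω → HeatChaos.H, HeatChaos.MemL2W P W V ∧
      HeatChaos.HasChaosExpansion P W V (fun α => u α t) ∧
      ∀ α, HeatChaos.chaosCoeff P W V α = u α t := fun t ht =>
    hW.exists_hasChaosExpansion (by simpa using hu.summable_pow_order_mul ht zero_le_one)
  choose! U hU using hex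
  refine ⟨fun t ht n => ⟨hu.summable_level ht.le n, hu.tsum_level_le ht.le n⟩, U, hU, ?_, ?_⟩
  · intro t ht q hq
    refine ⟨(hU t ht.le).1, ?_⟩
    simp only [(hU t ht.le).2.2]
    exact hu.summable_pow_order_mul ht.le (by linarith)
  · intro t ht p hp
    obtain ⟨h2, hexp, -⟩ := hU t ht
    have hC := HeatChaos.levelConst_nonneg ht
    refine hW.integrable_norm_rpow h2 hexp (A := fun n =>
      √(HeatChaos.levelConst t) ^ n * (n : ℝ) ^ (-(n : ℝ) * (1 / 4)) * ‖u₀‖)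
      (fun n => by positivity) (fun n s hs => ?_) (fun K hK => ?_) hp
    · have h1 := (hu.summable_level ht n).sum_le_tsum
        (s.subtype fun α => HeatChaos.order α = n) fun _ _ => sq_nonneg _
      rw [Finset.sum_subtype_of_mem (fun α => ‖u α t‖ ^ 2) hs] at h1
      refine h1.trans ((hu.tsum_level_le ht n).trans_eq ?_)
      have e : ((n : ℝ) ^ (-(n : ℝ) * (1 / 4))) ^ 2 = (n : ℝ) ^ (-(n : ℝ) / 2) := by
        rw [← Real.rpow_natCast, ← Real.rpow_mul (Nat.cast_nonneg _)]
        congr 1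
        push_cast
        ring
      rw [mul_pow, mul_pow, e, ← pow_mul, mul_comm n 2, pow_mul, Real.sq_sqrt hC]
    · refine ((HeatChaos.summable_pow_mul_rpow_neg (K * √(HeatChaos.levelConst t))
        (d := 1 / 4) (by norm_num)).mul_right ‖u₀‖).congr fun n => ?_
      rw [mul_pow]
      ring
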